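/- **Setting.** Let $\mathcal G$ be an acyclic directed mixed graph whose vertices $O$ are observed variables with values in standard Borel spaces; among them are a binary treatment $A$ and a real outcome $Y\neq A$. Fix $a_0\in\{0,1\}$, $a_1=1-a_0$, and a topological order $\prec$ of the vertices in which $Y$ is last and every vertex after $A$ is a descendant of $A$. Assume that $A$ is primal fixable: no child of $A$ lies in the district of $A$ (the set of vertices joined to $A$ by bidirected paths, $A$ included). Let $\mathcal L$ be the set of vertices $v\succeq A$ in the district of $A$, $\mathcal M$ the set of vertices $v\succ A$ outside it, and $\mathscr Z=(\mathcal M\cup\mathcal L)\setminus\{A,Y\}=\{Z_1\prec\dots\prec Z_K\}$, with $Z_{K+1}=Y$ (so $Z_1=Y$ if $\mathscr Z=\emptyset$). Put $a_v=a_0$ for $v\in\mathcal M$ and $a_v=a_1$ for $v\in\mathcal L$. The Markov pillow $\mathrm{mp}(v)$ consists of the district of $v$ and the parents of that district, in the subgraph on $v$ and its predecessors, without $v$; $\mathrm{mp}^{-A}(v)=\mathrm{mp}(v)\setminus\{A\}$. The model is nonparametric: for every $v\succeq A$, $\mathrm{mp}(v)$ is the set of all predecessors of $v$. Let $P$ be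 the law of $O$, with $E|Y|<\infty$, and let $O_1,O_2,\dots$ be i.i.d. with law $P$. Write $P_n$ for the empirical mean over $O_1,\dots,O_n$ and $\|f\|=(Pf^2)^{1/2}$. The target is $$\psi=E\Big[P(a_1\mid \mathrm{mp}(A))\int y\,dP(y\mid \mathrm{mp}^{-A}(y),a_Y)\prod_{k=1}^K dP(z_k\mid \mathrm{mp}^{-A}(z_k),a_{Z_k})\Big]+E[\mathbb I(A=a_0)Y].$$ **Nuisances.** $\mathscr B_Y=\mu=E[Y\mid \mathrm{mp}^{-A}(Y),A=a_Y]$ and, recursively, $\mathscr B_{Z_k}=E[\mathscr B_{Z_{k+1}}\mid \mathrm{mp}^{-A}(Z_k),A=a_{Z_k}]$; further $g_{Z_k}=P(A=a_{Z_k}\mid \mathrm{mp}^{-A}(Z_k))$ and $h_{Z_k}=P(A=a_{Z_k}\mid Z_k,\mathrm{mp}^{-A}(Z_k))$. A collection $Q=(\mathscr B,g,h)$ of functions of these arguments determines, by Bayes' rule, $\pi(a_1\mid\cdot)=1-g_{Z_1}$, $f^r_A=(1-g_{Z_1})/g_{Z_1}$, $f^r_{Z_k}=\frac{h_{Z_k}}{1-h_{Z_k}}\frac{1-g_{Z_k}}{g_{Z_k}}$,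 and for $v\in\mathscr Z\cup\{Y\}$ $$\mathscr R_v=\prod_{Z_i\in\mathcal M,\,Z_i\prec v}f^r_{Z_i}\ (v\in\mathcal L),\qquad \mathscr R_v=f^r_A\prod_{Z_i\in\mathcal L,\,Z_i\prec v}f^r_{Z_i}\ (v\in\mathcal M).$$ Given a value $c$ for the parameter, let $$\Phi(Q)=\mathbb I(A=a_Y)\mathscr R_Y\{Y-\mu\}+\sum_{k=1}^K\mathbb I(A=a_{Z_k})\mathscr R_{Z_k}\{\mathscr B_{Z_{k+1}}-\mathscr B_{Z_k}\}+\{\mathbb I(A=a_1)-\pi(a_1\mid\cdot)\}\mathscr B_{Z_1}+\pi(a_1\mid\cdot)\mathscr B_{Z_1}+\mathbb I(A=a_0)Y-c .$$ For the true $Q$, $c=\psi$; for an estimate $\hat Q$, $c$ is the plug-in estimate $\psi(\hat Q)=P_n[\hat\pi(a_1\mid\cdot)\hat{\mathscr B}_{Z_1}+\mathbb I(A=a_0)Y]$. The one-step estimator is $\psi^+(\hat Q)=\psi(\hat Q)+P_n\Phi(\hat Q)$. The TMLE is $\psi(\hat Q^*)$, where $\hat Q^*$ is any targeted estimate, i.e.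 $P_n\Phi(\hat Q^*)=o_P(n^{-1/2})$. **Regularity.** There is $\varepsilon>0$ such that $g_{Z_1}$, $g_{Z_k}$, $h_{Z_k}$ ($k\le K$) and their estimates lie in $[\varepsilon,1-\varepsilon]$ almost surely. Since $h_{Z_k}$ and $g_{Z_{k+1}}$ ($k<K$) are one and the same conditional probability of the treatment or its complement, so are their estimates: $\hat g_{Z_{k+1}}=\hat h_{Z_k}$ if $a_{Z_{k+1}}=a_{Z_k}$, and $\hat g_{Z_{k+1}}=1-\hat h_{Z_k}$ otherwise. Moreover $\|\hat{\mathscr B}_v-\mathscr B_v\|=O_P(1)$ for all $v\in\mathscr Z\cup\{Y\}$ (with $\hat{\mathscr B}_Y=\hat\mu$), and $\Phi(\hat Q)-\Phi(Q)$ lies almost surely in a fixed $P$-Donsker class. The estimates used in the TMLE, $\hat Q^*$, satisfy the same requirements. **Statement.** The one-step estimator $\psi^+(\hat Q)$ and the TMLE $\psi(\hat Q^*)$ converge in probability to $\psi$ if the estimates used in each of them ($\hat Q$, respectively $\hat Q^*$) satisfy simultaneously: 1. for all $Z_k\in\mathscr Z$ and all $Z_i\in\mathscr Z$ with $Z_i\prec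 Z_k$ and $a_{Z_i}\ne a_{Z_k}$: $\|\hat{\mathscr B}_{Z_k}-\mathscr B_{Z_k}\|=o_P(1)$, or both $\|\hat h_{Z_i}-h_{Z_i}\|=o_P(1)$ and $\|\hat g_{Z_i}-g_{Z_i}\|=o_P(1)$; 2. for all $Z_i\in\mathscr Z$ with $a_{Z_i}\neq a_Y$: $\|\hat\mu-\mu\|=o_P(1)$, or both $\|\hat h_{Z_i}-h_{Z_i}\|=o_P(1)$ and $\|\hat g_{Z_i}-g_{Z_i}\|=o_P(1)$; 3. for all $Z_k\in\mathcal M$ (including $Z_{K+1}=Y$, with $\mathscr B_Y=\mu$, if $Y\in\mathcal M$): $\|\hat{\mathscr B}_{Z_k}-\mathscr B_{Z_k}\|=o_P(1)$ or $\|\hat g_{Z_1}-g_{Z_1}\|=o_P(1)$. In particular, both estimators are consistent if all sequential regressions and $\mu$ are estimated consistently, or if all $h_{Z_k}$ and $g_{Z_k}$ (and $g_{Z_1}$) are. -/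

import Mathlib

open MeasureTheory ProbabilityTheory Filter Topology
open scoped ENNReal NNReal

noncomputable section

/-! ### Acyclic directed mixed graphs -/

/-- An acyclic directed mixed graph on the vertex set `V`: directed edges `dir u v` (`u → v`) without
directed cycles, and bidirected edges `bi u v` (`u ↔ v`). -/
structure ADMG (V : Type*) where
  dir : V → V → Prop
  bi : V → V → Prop
  bi_symm : ∀ u v, bi u v → bi v u
  bi_irrefl : ∀ v, ¬ bi v v
  acyclic : ∀ v, ¬ Relation.TransGen dir v v

namespace ADMG

variable {V : Type*} (G : ADMG V)

/-- The children of `v`. -/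
def children (v : V) : Set V := {u | G.dir v u}

/-- The district of `v`: all vertices joined to `v` by a bidirected path (`v` included). -/
def district (v : V) : Set V := {u | Relation.ReflTransGen G.bi v u}

/-- `v` is primal fixable if its children and its district do not overlap. -/
def PrimalFixable (v : V) : Prop := Disjoint (G.children v) (G.district v)

/-- The given linear order of the vertices is a valid topological order. -/
def Topological [LinearOrder V] : Prop := ∀ u v, G.dir u v → u < v

/-- The district of `v` in the subgraph on `v` and the vertices that precede `v`. -/
def districtUpTo [LinearOrder V] (v : V) : Set V :=
  {u | Relation.ReflTransGen (fun a b => G.bi a b ∧ a ≤ v ∧ b ≤ v) v u}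

/-- The Markov pillow of `v`: the district of `v` together with the parents of that district, in the
subgraph on `v` and the vertices that precede `v`, without `v` itself. -/
def markovPillow [LinearOrder V] (v : V) : Set V :=
  {u | u ≠ v ∧ u ≤ v ∧ (u ∈ G.districtUpTo v ∨ ∃ w ∈ G.districtUpTo v, G.dir u w)}

end ADMG

/-! ### Recursion along the topological order, from the last vertex backwards -/

section Backward

variable {V β : Type*} [LinearOrder V] [Finite V] [SuccOrder V]

/-- `backward step b v = step v (backward step b (v + 1))`, where `v + 1` is the immediate successor
of `v`, and `backward step b v = step v b` at the last vertex. -/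
def backward (step : V → β → β) (b : β) : V → β :=
  (wellFounded_gt (α := V)).fix fun v ih =>
    open Classical in
    step v (if h : IsMax v then b else ih (Order.succ v) (Order.lt_succ_of_not_isMax h))

open Classical in
theorem backward_eq (step : V → β → β) (b : β) (v : V) :
    backward step b v = step v (if IsMax v then b else backward step b (Order.succ v)) := by
  unfold backward
  rw [WellFounded.fix_eq]
  by_cases h : IsMax v <;> simp [h]

end Backward

/-! ### Treatment, outcome, and the partition of the vertices -/

/-- The ADMG with its treatment vertex `A` (a binary variable), its outcome vertex `Y` (a real
variable) and the treatment level `a₀` of interest. The vertex `v` carries a variable with values in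
`S v`. The topological order is the linear order of `V`. -/
structure Design (V : Type*) (S : V → Type*) [∀ v, MeasurableSpace (S v)] where
  G : ADMG V
  A : V
  Y : V
  trt : S A ≃ᵐ Bool
  out : S Y ≃ᵐ ℝ
  a₀ : Bool

namespace Design

variable {V : Type*} [Fintype V] [LinearOrder V] [SuccOrder V]
  {S : V → Type*} [∀ v, MeasurableSpace (S v)] (D : Design V S)

/-- The other treatment level, `a₁ = 1 - a₀`. -/
def a₁ : Bool := !D.a₀

/-- The standing assumptions on the graph and on the topological order: `A` is primal fixable, every
vertex after `A` is a descendant of `A`, and `Y` is the last vertex. -/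
structure Admissible : Prop where
  topological : D.G.Topological
  primalFixable : D.G.PrimalFixable D.A
  ne : D.A ≠ D.Y
  last : ∀ v, v ≤ D.Y
  descendants : ∀ v, D.A < v → Relation.ReflTransGen D.G.dir D.A v

/-- The topological factorization leaves the law of the treatment and of the post-treatment variables
unrestricted: the Markov pillow of each of them consists of all its predecessors. -/
def Nonparametric : Prop := ∀ v, D.A ≤ v → D.G.markovPillow v = {u | u < v}

/-- `𝓛`: the vertices in the district of `A` that do not precede `A` (`A` included). -/
def L : Set V := {v | D.A ≤ v ∧ v ∈ D.G.district D.A}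

/-- `𝓜`: the post-treatment vertices outside the district of `A`. -/
def M : Set V := {v | D.A < v ∧ v ∉ D.G.district D.A}

/-- `𝓩`: the post-treatment vertices other than the outcome. -/
def Z : Finset V := Finset.univ.filter fun v => D.A < v ∧ v ≠ D.Y

/-- `Z₁`: the vertex that follows `A` immediately (the outcome if `𝓩` is empty). -/
def Z₁ : V := Order.succ D.A

open Classical in
/-- The treatment level `a_v`: it is `a₁` for `v ∈ 𝓛` and `a₀` for `v ∈ 𝓜`. -/
def lvl (v : V) : Bool := if v ∈ D.L then D.a₁ else D.a₀

/-- The Markov pillow of `v` without the treatment. -/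
def mpA (v : V) : Set V := D.G.markovPillow v \ {D.A}

/-- The σ-algebra generated by the variables in `s`. A function is measurable with respect to it iff
it is a measurable function of these variables. -/
abbrev sig (_D : Design V S) (s : Set V) : MeasurableSpace (∀ v, S v) :=
  MeasurableSpace.comap s.domRestrict MeasurableSpace.pi

/-- The outcome. -/
def y (o : ∀ v, S v) : ℝ := D.out (o D.Y)

/-- The event that the treatment takes the value `a`. -/
def trtEq (a : Bool) : Set (∀ v, S v) := {o | D.trt (o D.A) = a}

/-- The indicator of `A = a`. -/
def ind (a : Bool) : (∀ v, S v) → ℝ := (D.trtEq a).indicator 1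

/-! ### The true nuisance functions and the target parameter -/

variable (P : Measure (∀ v, S v))

/-- The sequential regressions: `𝓑_Y = E[Y | mp⁻ᴬ(Y), A = a_Y]` is the outcome regression `μ`, and
`𝓑_v = E[𝓑_{v+1} | mp⁻ᴬ(v), A = a_v]`. Conditioning on `A = a` means passing to the measure
`P(· | A = a)`. -/
def seqReg : V → (∀ v, S v) → ℝ :=
  backward (fun v f => (P[|D.trtEq (D.lvl v)])[f | D.sig (D.mpA v)]) D.y

/-- `g_v = P(A = a_v | mp⁻ᴬ(v))`. -/
def trueG (v : V) : (∀ v, S v) → ℝ := P[D.ind (D.lvl v) | D.sig (D.mpA v)]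

/-- `h_v = P(A = a_v | O_v, mp⁻ᴬ(v))`. -/
def trueH (v : V) : (∀ v, S v) → ℝ := P[D.ind (D.lvl v) | D.sig (insert v (D.mpA v))]

/-- The propensity score `π(a | mp(A)) = P(A = a | mp(A))`. -/
def propensity (a : Bool) : (∀ v, S v) → ℝ := P[D.ind a | D.sig (D.G.markovPillow D.A)]

section Target

variable [∀ v, StandardBorelSpace (S v)] [∀ v, Nonempty (S v)]

/-- The integrals `∫ y dP(y | mp⁻ᴬ(y), a_Y) ∏_{u ≥ v} dP(u | mp⁻ᴬ(u), a_u)` over the variables from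
`v` on, as functions of the variables before `v`; the conditional laws are regular conditional
distributions. -/
def iterInt [IsFiniteMeasure P] : V → (∀ v, S v) → ℝ :=
  backward (fun v f o =>
    ∫ z, f (Function.update o v z)
      ∂(condDistrib (fun o' : ∀ v, S v => o' v) (D.mpA v).domRestrict (P[|D.trtEq (D.lvl v)])
        ((D.mpA v).domRestrict o))) D.y

/-- The target parameter
`ψ = E[P(a₁ | mp(A)) ∫ y dP(y | mp⁻ᴬ(y), a_Y) ∏_{Z_k} dP(z_k | mp⁻ᴬ(z_k), a_{Z_k})] + E[I(A = a₀) Y]`.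
-/
def target [IsFiniteMeasure P] : ℝ :=
  (∫ o, D.propensity P D.a₁ o * D.iterInt P D.Z₁ o ∂P) + ∫ o, D.ind D.a₀ o * D.y o ∂P

end Target

/-! ### Nuisance collections, influence function, estimators -/

/-- A collection of nuisance functions in the Bayes parameterization: sequential regressions `B v`
(with `B Y` in the role of the outcome regression `μ`) and binary regressions `g v`, `h v`. Each is a
measurable function of its own arguments: `B v` and `g v` of `mp⁻ᴬ(v)`, and `h v` of `v` and
`mp⁻ᴬ(v)`. -/
structure Nuisance where
  B : V → (∀ v, S v) → ℝ
  g : V → (∀ v, S v) → ℝ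
  h : V → (∀ v, S v) → ℝ
  measurable_B : ∀ v, @Measurable _ _ (D.sig (D.mpA v)) _ (B v)
  measurable_g : ∀ v, @Measurable _ _ (D.sig (D.mpA v)) _ (g v)
  measurable_h : ∀ v, @Measurable _ _ (D.sig (insert v (D.mpA v))) _ (h v)

/-- The true nuisance collection. -/
def trueQ : D.Nuisance where
  B := D.seqReg P
  g := D.trueG P
  h := D.trueH P
  measurable_B v := by
    unfold seqReg
    rw [backward_eq]
    exact stronglyMeasurable_condExp.measurable
  measurable_g _ := stronglyMeasurable_condExp.measurable
  measurable_h _ := stronglyMeasurable_condExp.measurable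

namespace Nuisance

variable {D}
variable (Q : D.Nuisance)

/-- The density ratio `f^r_v` of a mediator through the rule of Bayes,
`(h_v / (1 - h_v)) * ((1 - g_v) / g_v)`. -/
def ratio (v : V) (o : ∀ v, S v) : ℝ :=
  Q.h v o / (1 - Q.h v o) * ((1 - Q.g v o) / Q.g v o)

/-- The propensity score `π(a₁ | mp(A)) = 1 - g_{Z₁}`. -/
def pi₁ (o : ∀ v, S v) : ℝ := 1 - Q.g D.Z₁ o

/-- The treatment ratio `f^r_A = (1 - g_{Z₁}) / g_{Z₁}`. -/
def ratioA (o : ∀ v, S v) : ℝ := (1 - Q.g D.Z₁ o) / Q.g D.Z₁ o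

open Classical in
/-- `𝓡_v`: for `v ∈ 𝓛` the product of the ratios of the mediators in `𝓜` that precede `v`; for
`v ∈ 𝓜` the product of `f^r_A` and the ratios of the mediators in `𝓛` that precede `v`. -/
def R (v : V) (o : ∀ v, S v) : ℝ :=
  if v ∈ D.L then ∏ i ∈ D.Z with i ∈ D.M ∧ i < v, Q.ratio i o
  else Q.ratioA o * ∏ i ∈ D.Z with i ∈ D.L ∧ i < v, Q.ratio i o

/-- The influence function `Φ(Q)`, with the value of the parameter at `Q` written as `c`. For
`v = Z_k`, the vertex `Order.succ v` is `Z_{k+1}`, with `Z_{K+1} = Y` and `B Y = μ`. -/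
def eif (c : ℝ) (o : ∀ v, S v) : ℝ :=
  D.ind (D.lvl D.Y) o * Q.R D.Y o * (D.y o - Q.B D.Y o)
    + ∑ v ∈ D.Z, D.ind (D.lvl v) o * Q.R v o * (Q.B (Order.succ v) o - Q.B v o)
    + (D.ind D.a₁ o - Q.pi₁ o) * Q.B D.Z₁ o
    + Q.pi₁ o * Q.B D.Z₁ o + D.ind D.a₀ o * D.y o - c

/-- The plug-in estimator based on a sample of size `n`. -/
def plugin (n : ℕ) (x : Fin n → ∀ v, S v) : ℝ :=
  (∑ j, Q.pi₁ (x j) * Q.B D.Z₁ (x j)) / n + (∑ j, D.ind D.a₀ (x j) * D.y (x j)) / n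

/-- The empirical mean `P_n Φ(Q)` of the influence function at `Q`. -/
def empEif (n : ℕ) (x : Fin n → ∀ v, S v) : ℝ :=
  (∑ j, Q.eif (Q.plugin n x) (x j)) / n

/-- The one-step estimator: the plug-in estimator plus `P_n Φ(Q)`. -/
def oneStep (n : ℕ) (x : Fin n → ∀ v, S v) : ℝ := Q.plugin n x + Q.empEif n x

/-- The targeted minimum loss estimator, for a targeted nuisance collection `Q`: the plug-in estimator
at `Q`. -/
def tmle (n : ℕ) (x : Fin n → ∀ v, S v) : ℝ := Q.plugin n x

end Nuisance

end Design

/-! ### Stochastic orders and Donsker classes -/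

section Stochastic

variable {Ω : Type*} [MeasurableSpace Ω]

/-- `X_n = o_p(1)` for nonnegative `X_n` (in outer probability where `X_n` is not measurable). -/
def IsLittleOP (ρ : Measure Ω) (X : ℕ → Ω → ℝ≥0∞) : Prop :=
  ∀ ε : ℝ≥0∞, 0 < ε → Tendsto (fun n => ρ {ω | ε ≤ X n ω}) atTop (𝓝 0)

/-- `X_n = O_p(1)` for nonnegative `X_n`. -/
def IsBigOP (ρ : Measure Ω) (X : ℕ → Ω → ℝ≥0∞) : Prop :=
  ∀ δ : ℝ≥0∞, 0 < δ → ∃ C : ℝ≥0, ∀ᶠ n in atTop, ρ {ω | (C : ℝ≥0∞) < X n ω} ≤ δ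

/-- The outer expectation of a bounded real function. -/
def outerExp (μ : Measure Ω) (T : Ω → ℝ) : ℝ :=
  sInf {r | ∃ U : Ω → ℝ, Measurable U ∧ Integrable U μ ∧ (∀ x, T x ≤ U x) ∧ r = ∫ x, U x ∂μ}

/-- The empirical process `√n (P_n - P) f`. -/
def empProc (P : Measure Ω) (n : ℕ) (x : Fin n → Ω) (f : Ω → ℝ) : ℝ :=
  √(n : ℝ) * ((∑ i, f (x i)) / n - ∫ o, f o ∂P)

/-- `F` is a `P`-Donsker class: it consists of measurable square integrable functions, and the
empirical process indexed by `F`, a map into `ℓ^∞(F)`, converges weakly (in the sense of outer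
expectations of bounded continuous functions) to a tight Borel probability measure on `ℓ^∞(F)`. -/
structure IsDonsker (P : Measure Ω) (F : Set (Ω → ℝ)) : Prop where
  measurable : ∀ f ∈ F, Measurable f
  memLp : ∀ f ∈ F, MemLp f 2 P
  weak : ∃ Z : ∀ n, (Fin n → Ω) → lp (fun _ : F => ℝ) ∞,
    (∀ n x (f : F), (Z n x : F → ℝ) f = empProc P n x f) ∧
    ∃ ν : @Measure (lp (fun _ : F => ℝ) ∞) (borel _),
      ν Set.univ = 1 ∧
      (∀ ε : ℝ≥0∞, 0 < ε → ∃ K : Set (lp (fun _ : F => ℝ) ∞), IsCompact K ∧ ν Kᶜ ≤ ε) ∧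
      ∀ H : BoundedContinuousFunction (lp (fun _ : F => ℝ) ∞) ℝ,
        Tendsto (fun n => outerExp (Measure.pi fun _ : Fin n => P) fun x => H (Z n x)) atTop
          (𝓝 (∫ z, H z ∂ν))

end Stochastic

/-! ### Hypotheses on the nuisance estimates -/

namespace Design

variable {V : Type*} [Fintype V] [LinearOrder V] [SuccOrder V]
  {S : V → Type*} [∀ v, MeasurableSpace (S v)] (D : Design V S)
  (P : Measure (∀ v, S v)) {Ω : Type*} [MeasurableSpace Ω] (ρ : Measure Ω)

/-- The first `n` observations. -/
def sample (O : ℕ → Ω → ∀ v, S v) (n : ℕ) (ω : Ω) : Fin n → ∀ v, S v := fun j => O j ω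

variable {D} in
/-- Uniform positivity of a nuisance collection: the probabilities `g_v`, `h_v` (`v ∈ 𝓩`) and
`g_{Z₁}` lie in `[ε, 1 - ε]` almost surely. -/
def Nuisance.Positive (Q : D.Nuisance) (ε : ℝ) : Prop :=
  (∀ᵐ o ∂P, Q.g D.Z₁ o ∈ Set.Icc ε (1 - ε)) ∧
  ∀ v ∈ D.Z, ∀ᵐ o ∂P, Q.g v o ∈ Set.Icc ε (1 - ε) ∧ Q.h v o ∈ Set.Icc ε (1 - ε)

variable {D} in
/-- Both `h_{Z_k}` and `g_{Z_{k+1}}` stand for the conditional law of the treatment given `Z_k` and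
the variables before `Z_k` other than `A`, at the levels `a_{Z_k}` and `a_{Z_{k+1}}`; in a coherent
collection they are the same function or complementary, accordingly. -/
def Nuisance.Coherent (Q : D.Nuisance) : Prop :=
  ∀ v ∈ D.Z, Order.succ v ∈ D.Z → ∀ᵐ o ∂P,
    Q.g (Order.succ v) o = if D.lvl (Order.succ v) = D.lvl v then Q.h v o else 1 - Q.h v o

/-- `‖𝓑̂_v - 𝓑_v‖ = o_p(1)` in `L²(P)`; for `v = Y` this is `‖μ̂ - μ‖ = o_p(1)`. -/
def ConsB (Qh : ℕ → Ω → D.Nuisance) (v : V) : Prop :=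
  IsLittleOP ρ fun n ω => eLpNorm ((Qh n ω).B v - D.seqReg P v) 2 P

/-- `‖ĝ_v - g_v‖ = o_p(1)` in `L²(P)`. -/
def ConsG (Qh : ℕ → Ω → D.Nuisance) (v : V) : Prop :=
  IsLittleOP ρ fun n ω => eLpNorm ((Qh n ω).g v - D.trueG P v) 2 P

/-- `‖ĥ_v - h_v‖ = o_p(1)` in `L²(P)`. -/
def ConsH (Qh : ℕ → Ω → D.Nuisance) (v : V) : Prop :=
  IsLittleOP ρ fun n ω => eLpNorm ((Qh n ω).h v - D.trueH P v) 2 P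

/-- The three disjunctive conditions. In the third one `v` ranges over `𝓜`, which contains `Y` if `Y`
is outside the district of `A`. -/
structure RobustConditions (Qh : ℕ → Ω → D.Nuisance) : Prop where
  mediators : ∀ v ∈ D.Z, ∀ u ∈ D.Z, u < v → D.lvl u ≠ D.lvl v →
    D.ConsB P ρ Qh v ∨ (D.ConsH P ρ Qh u ∧ D.ConsG P ρ Qh u)
  outcome : ∀ u ∈ D.Z, D.lvl u ≠ D.lvl D.Y →
    D.ConsB P ρ Qh D.Y ∨ (D.ConsH P ρ Qh u ∧ D.ConsG P ρ Qh u)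
  treatment : ∀ v ∈ D.M, D.ConsB P ρ Qh v ∨ D.ConsG P ρ Qh D.Z₁

/-- The regularity conditions on the nuisance estimates `Qh n ω` (from `n` observations): uniform
positivity, coherence, regression errors bounded in probability in `L²(P)`, and almost sure membership
of `Φ(Q̂) - Φ(Q)` in a fixed `P`-Donsker class. -/
structure RegularEstimates [∀ v, StandardBorelSpace (S v)] [∀ v, Nonempty (S v)]
    [IsFiniteMeasure P] (O : ℕ → Ω → ∀ v, S v) (Qh : ℕ → Ω → D.Nuisance) : Prop where
  positive : ∃ ε : ℝ, 0 < ε ∧ ∀ n, ∀ᵐ ω ∂ρ, (Qh n ω).Positive P ε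
  coherent : ∀ n, ∀ᵐ ω ∂ρ, (Qh n ω).Coherent P
  bounded : ∀ v, D.A < v → IsBigOP ρ fun n ω => eLpNorm ((Qh n ω).B v - D.seqReg P v) 2 P
  donsker : ∃ F : Set ((∀ v, S v) → ℝ), IsDonsker P F ∧ ∀ n, ∀ᵐ ω ∂ρ,
    (Qh n ω).eif ((Qh n ω).plugin n (sample O n ω)) - (D.trueQ P).eif (D.target P) ∈ F

/-- The defining property of targeted estimates `Q̂*`: `P_n Φ(Q̂*) = o_p(n^{-1/2})`. -/
def Targeted (O : ℕ → Ω → ∀ v, S v) (Qh : ℕ → Ω → D.Nuisance) : Prop :=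
  IsLittleOP ρ fun n ω => ENNReal.ofReal (√(n : ℝ) * |(Qh n ω).empEif n (sample O n ω)|)

end Design

end

/-! Write `eif 0` for the uncentred influence function. The plug-in centring cancels, so the
one-step estimator is the empirical mean of `eif 0` at Q̂ (`Nuisance.oneStep_eq`). Its error splits
into three pieces (`Nuisance.oneStep_sub_eq`): the centred empirical mean of Φ(Q̂) − Φ(Q),
negligible by the Donsker property; the centred empirical mean at the true Q, negligible by the weak
law; and the bias P(eif 0)(Q̂) − ψ.

The bias consists of products of errors. Expand `eif 0` around the true regressions
(`Nuisance.RegularAt.eif_eq`). The residuals of the true regressions have mean zero whatever the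
estimated weights, and I(A = a₁)𝓑_{Z₁} + I(A = a₀)Y has mean ψ (`target_eq`). The rest is linear in
the regression errors. Telescoping gives the error at v + 1 the coefficient I(A = a_v)𝓡_v − I(A =
a_{v+1})𝓡_{v+1}. By coherence, the 𝓜-weight divided by the 𝓛-weight is the odds of a₁ given the past
(`Nuisance.RegularAt.weightM_mul`). Hence this coefficient is 0 if a_v = a_{v+1}, and (𝓡_v +
𝓡_{v+1})(I(A = a_v) − ĥ_v) otherwise. At Z₁ a similar factor I(A = a₀) − ĝ_{Z₁} appears. Replacing
the indicators by their regressions and applying Cauchy–Schwarz leaves products of a regression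
error with the error of ĥ_v or ĝ_{Z₁}. In each product the disjunctive conditions make one factor
o_P(1), and the other is O_P(1).

The TMLE differs from the one-step estimator, at the same nuisances, by P_nΦ(Q̂*), which is
negligible. -/

set_option linter.unusedSectionVars false

/-! ### Regressions within a stratum, and passing from the stratum to the whole law. -/

section ConditioningOnEvent

variable {Ω : Type*} {m mΩ : MeasurableSpace Ω} {P : Measure Ω} {s : Set Ω}

theorem integrable_mul_condExp {D f : Ω → ℝ} (hD : StronglyMeasurable[m] D)
    (hf : Integrable f P) (hDf : Integrable (fun o => D o * f o) P) :
    Integrable (fun o => D o * (P[f|m]) o) P :=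
  integrable_condExp.congr (condExp_mul_of_stronglyMeasurable_left hD hDf hf)

theorem integral_mul_condExp [IsFiniteMeasure P] (hm : m ≤ mΩ) {D f : Ω → ℝ}
    (hD : StronglyMeasurable[m] D) (hf : Integrable f P)
    (hDf : Integrable (fun o => D o * f o) P) :
    ∫ o, D o * (P[f|m]) o ∂P = ∫ o, D o * f o ∂P := by
  have h := integral_condExp (μ := P) (f := D * f) hm
  rw [integral_congr_ae (condExp_mul_of_stronglyMeasurable_left hD hDf hf)] at h
  exact h

theorem integrable_cond {f : Ω → ℝ} (hf : Integrable f P) : Integrable f P[|s] := by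
  by_cases hs : P s = 0
  · rw [cond_eq_zero_of_meas_eq_zero hs]
    exact integrable_zero_measure
  · exact hf.restrict.smul_measure (ENNReal.inv_ne_top.2 hs)

theorem integral_indicator_one_mul [IsFiniteMeasure P] (hs : MeasurableSet s) (f : Ω → ℝ) :
    ∫ o, s.indicator 1 o * f o ∂P = P.real s * ∫ o, f o ∂P[|s] := by
  have h : (fun o => s.indicator (1 : Ω → ℝ) o * f o) = s.indicator f := by
    ext o
    by_cases ho : o ∈ s <;> simp [ho]
  rw [h, integral_indicator hs, ProbabilityTheory.cond, integral_smul_measure]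
  by_cases h0 : P s = 0
  · simp [Measure.restrict_eq_zero.2 h0]
  · have h0' : P.real s ≠ 0 := by
      rw [Measure.real, ENNReal.toReal_ne_zero]
      exact ⟨h0, measure_ne_top _ _⟩
    rw [ENNReal.toReal_inv, ← Measure.real, smul_eq_mul, ← mul_assoc, mul_inv_cancel₀ h0', one_mul]

/-- Weighted residuals of a regression within the stratum `s` have mean zero. -/
theorem integral_indicator_mul_sub_condExp_eq_zero [IsFiniteMeasure P] (hm : m ≤ mΩ)
    (hs : MeasurableSet s) {f R : Ω → ℝ} (hf : Integrable f P) (hR : StronglyMeasurable[m] R)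
    {C : ℝ} (hC : ∀ᵐ o ∂P, |R o| ≤ C) :
    ∫ o, s.indicator 1 o * R o * (f o - (P[|s][f|m]) o) ∂P = 0 := by
  simp_rw [mul_assoc]
  rw [integral_indicator_one_mul hs]
  have hC' : ∀ᵐ o ∂P[|s], |R o| ≤ C := cond_absolutelyContinuous.ae_le hC
  have hR' := (hR.mono hm).aestronglyMeasurable (μ := P[|s])
  simp_rw [mul_sub]
  rw [integral_sub ((integrable_cond hf).bdd_mul hR' hC')
    (integrable_condExp.bdd_mul hR' hC'), integral_mul_condExp hm hR (integrable_cond hf)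
      ((integrable_cond hf).bdd_mul hR' hC'),
    sub_self, mul_zero]

/-- Integrating the lower bound ε for P(s | m) over t gives ε P(t) ≤ P(s ∩ t), which is at most P(t
| s). So, on m, null sets of the stratum are null sets of `P`. This is how positivity enters the
identification of ψ. -/
theorem measure_le_inv_mul_cond [IsProbabilityMeasure P] (hm : m ≤ mΩ) (hs : MeasurableSet s)
    {ε : ℝ} (hε : 0 < ε) (hpos : ∀ᵐ o ∂P, ε ≤ (P[s.indicator (1 : Ω → ℝ)|m]) o)
    {t : Set Ω} (ht : MeasurableSet[m] t) :
    P t ≤ (ENNReal.ofReal ε)⁻¹ * P[|s] t := by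
  have hint : Integrable (s.indicator (1 : Ω → ℝ)) P := (integrable_const (1 : ℝ)).indicator hs
  have h1 : ε * P.real t ≤ P.real (s ∩ t) := by
    have h2 := setIntegral_condExp hm hint ht
    rw [integral_indicator_one hs, measureReal_restrict_apply hs] at h2
    rw [← h2, mul_comm, ← smul_eq_mul, ← setIntegral_const]
    exact setIntegral_mono_ae (integrable_const _).integrableOn integrable_condExp.integrableOn hpos
  have h3 : ENNReal.ofReal ε * P t ≤ P (s ∩ t) := by
    rw [← ofReal_measureReal (μ := P) (s := t), ← ofReal_measureReal (μ := P) (s := s ∩ t),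
      ← ENNReal.ofReal_mul hε.le]
    exact ENNReal.ofReal_le_ofReal h1
  have h4 : P (s ∩ t) ≤ P[|s] t := by
    rw [← cond_mul_eq_inter hs]
    exact mul_le_of_le_one_right' prob_le_one
  rw [mul_comm, ← div_eq_mul_inv, ENNReal.le_div_iff_mul_le
    (Or.inl (by simpa using hε)) (Or.inl ENNReal.ofReal_ne_top), mul_comm]
  exact h3.trans h4

theorem trim_le_inv_smul_cond_trim [IsProbabilityMeasure P] (hm : m ≤ mΩ) (hs : MeasurableSet s)
    {ε : ℝ} (hε : 0 < ε) (hpos : ∀ᵐ o ∂P, ε ≤ (P[s.indicator (1 : Ω → ℝ)|m]) o) :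
    P.trim hm ≤ (ENNReal.ofReal ε)⁻¹ • (P[|s]).trim hm := by
  refine Measure.le_iff.2 fun t ht => ?_
  rw [Measure.smul_apply, trim_measurableSet_eq hm ht, trim_measurableSet_eq hm ht, smul_eq_mul]
  exact measure_le_inv_mul_cond hm hs hε hpos ht

/-- The domination of `P` by the stratum law holds only on m, so the comparison is made between the
trimmed measures. -/
theorem integrable_of_integrable_cond [IsProbabilityMeasure P] (hm : m ≤ mΩ) (hs : MeasurableSet s)
    {ε : ℝ} (hε : 0 < ε) (hpos : ∀ᵐ o ∂P, ε ≤ (P[s.indicator (1 : Ω → ℝ)|m]) o) {f : Ω → ℝ}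
    (hf : StronglyMeasurable[m] f) (hint : Integrable f P[|s]) : Integrable f P := by
  refine integrable_of_integrable_trim hm ?_
  refine ((hint.trim hm hf).smul_measure (c := (ENNReal.ofReal ε)⁻¹) ?_).mono_measure
    (trim_le_inv_smul_cond_trim hm hs hε hpos)
  simpa using hε

theorem ae_eq_of_ae_eq_cond [IsProbabilityMeasure P] (hm : m ≤ mΩ) (hs : MeasurableSet s)
    {ε : ℝ} (hε : 0 < ε) (hpos : ∀ᵐ o ∂P, ε ≤ (P[s.indicator (1 : Ω → ℝ)|m]) o) {f f' : Ω → ℝ}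
    (hf : StronglyMeasurable[m] f) (hf' : StronglyMeasurable[m] f') (h : f =ᵐ[P[|s]] f') :
    f =ᵐ[P] f' := by
  have ht : MeasurableSet[m] {o | f o = f' o} :=
    hf.measurableSet_eq_fun hf'
  have h0 := measure_le_inv_mul_cond hm hs hε hpos ht.compl
  have h1 : P[|s] {o | f o = f' o}ᶜ = 0 := h
  rw [h1, mul_zero, nonpos_iff_eq_zero] at h0
  exact h0

end ConditioningOnEvent

/-! ### Bounds for means of products of errors. -/

section CauchySchwarz

variable {Ω : Type*} {m mΩ : MeasurableSpace Ω} {P : Measure Ω}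

/-- Hölder with exponents 2 and 2 after pulling out the bounded factor. Extended norms make square
integrability of the factors unnecessary. -/
theorem enorm_integral_mul_mul_le {D T E : Ω → ℝ} (hD : AEStronglyMeasurable D P)
    (hE : AEStronglyMeasurable E P) {C : ℝ} (hC : ∀ᵐ o ∂P, |T o| ≤ C) :
    ‖∫ o, D o * T o * E o ∂P‖ₑ ≤ ENNReal.ofReal C * (eLpNorm D 2 P * eLpNorm E 2 P) := by
  calc ‖∫ o, D o * T o * E o ∂P‖ₑ ≤ ∫⁻ o, ‖D o * T o * E o‖ₑ ∂P := enorm_integral_le_lintegral_enorm _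
    _ ≤ ∫⁻ o, ENNReal.ofReal C * (‖D o‖ₑ * ‖E o‖ₑ) ∂P := by
        refine lintegral_mono_ae ?_
        filter_upwards [hC] with o ho
        rw [enorm_mul, enorm_mul, mul_right_comm, mul_comm]
        refine mul_le_mul' ?_ le_rfl
        rw [Real.enorm_eq_ofReal_abs]
        exact ENNReal.ofReal_le_ofReal ho
    _ = ENNReal.ofReal C * ∫⁻ o, ‖D o‖ₑ * ‖E o‖ₑ ∂P := lintegral_const_mul' _ _ ENNReal.ofReal_ne_top
    _ ≤ _ := by
        gcongr
        have h := ENNReal.lintegral_mul_le_Lp_mul_Lq P Real.HolderConjugate.two_two hD.enorm hE.enorm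
        rw [eLpNorm_eq_lintegral_rpow_enorm_toReal (by norm_num) (by norm_num),
          eLpNorm_eq_lintegral_rpow_enorm_toReal (by norm_num) (by norm_num)]
        simpa using h

/-- In the mean of `D T (f - e)`, with `D`, `T` and `e` functions of `m`, one may replace `f` by its
regression on `m`; the Cauchy-Schwarz inequality bounds the result. -/
theorem enorm_integral_mul_sub_le [IsFiniteMeasure P] (hm : m ≤ mΩ) {D T e f : Ω → ℝ}
    (hDm : StronglyMeasurable[m] D) (hTm : StronglyMeasurable[m] T) (hem : StronglyMeasurable[m] e)
    (hD : Integrable D P) (hf : AEStronglyMeasurable f P) {C K : ℝ} (hC : ∀ᵐ o ∂P, |T o| ≤ C)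
    (hfK : ∀ᵐ o ∂P, |f o| ≤ K) (heK : ∀ᵐ o ∂P, |e o| ≤ K) :
    ‖∫ o, D o * T o * (f o - e o) ∂P‖ₑ ≤
      ENNReal.ofReal C * (eLpNorm D 2 P * eLpNorm (e - P[f|m]) 2 P) := by
  have hfi : Integrable f P := Integrable.of_bound hf K hfK
  have hDT : Integrable (fun o => D o * T o) P :=
    hD.mul_bdd (hTm.mono hm).aestronglyMeasurable hC
  have hDTf : Integrable (fun o => D o * T o * f o) P := hDT.mul_bdd hf hfK
  have hDTe : Integrable (fun o => D o * T o * e o) P :=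
    hDT.mul_bdd (hem.mono hm).aestronglyMeasurable heK
  have hDTc : Integrable (fun o => D o * T o * (P[f|m]) o) P :=
    integrable_mul_condExp (hDm.mul hTm) hfi hDTf
  have h1 : ∫ o, D o * T o * f o ∂P = ∫ o, D o * T o * (P[f|m]) o ∂P :=
    (integral_mul_condExp hm (hDm.mul hTm) hfi hDTf).symm
  have h3 : ∫ o, D o * T o * (f o - e o) ∂P = -∫ o, D o * T o * (e - P[f|m]) o ∂P := by
    simp_rw [Pi.sub_apply, mul_sub]
    rw [integral_sub hDTf hDTe, integral_sub hDTe hDTc, h1]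
    ring
  rw [h3, enorm_neg]
  exact enorm_integral_mul_mul_le (hDm.mono hm).aestronglyMeasurable
    ((hem.mono hm).sub (stronglyMeasurable_condExp.mono hm)).aestronglyMeasurable hC

end CauchySchwarz

/-! ### Calculus of o_P and O_P for possibly nonmeasurable variables. -/

section StochasticOrders

variable {Ω : Type*} [MeasurableSpace Ω] {ρ : Measure Ω} {X X' : ℕ → Ω → ℝ≥0∞}

theorem IsLittleOP.mono_ae (hX' : IsLittleOP ρ X') (h : ∀ᶠ n in atTop, ∀ᵐ ω ∂ρ, X n ω ≤ X' n ω) :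
    IsLittleOP ρ X := fun ε hε =>
  tendsto_of_tendsto_of_tendsto_of_le_of_le' tendsto_const_nhds (hX' ε hε)
    (Eventually.of_forall fun _ => zero_le)
    (h.mono fun _ hn => measure_mono_ae (hn.mono fun _ hω hε => le_trans hε hω))

theorem IsLittleOP.add (hX : IsLittleOP ρ X) (hX' : IsLittleOP ρ X') :
    IsLittleOP ρ fun n ω => X n ω + X' n ω := by
  intro ε hε
  have hε2 : 0 < ε / 2 := ENNReal.half_pos hε.ne'
  have h := (hX _ hε2).add (hX' _ hε2)
  rw [add_zero] at h
  refine tendsto_of_tendsto_of_tendsto_of_le_of_le tendsto_const_nhds h (fun _ => zero_le)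
    fun n => (measure_mono fun ω hω => ?_).trans (measure_union_le _ _)
  by_contra hc
  simp only [Set.mem_union, Set.mem_ofPred_eq, not_or, not_le] at hc hω
  exact absurd ((ENNReal.add_lt_add hc.1 hc.2).trans_eq (ENNReal.add_halves ε)) (not_lt.2 hω)

theorem IsLittleOP.zero : IsLittleOP ρ fun _ _ => 0 := by
  intro ε hε
  have h : {ω : Ω | ε ≤ 0} = ∅ := by
    ext ω
    simp [hε.ne']
  simp only [h, measure_empty]
  exact tendsto_const_nhds

theorem IsLittleOP.sum {ι : Type*} (s : Finset ι) {X : ι → ℕ → Ω → ℝ≥0∞}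
    (h : ∀ i ∈ s, IsLittleOP ρ (X i)) : IsLittleOP ρ fun n ω => ∑ i ∈ s, X i n ω := by
  classical
  induction s using Finset.induction_on with
  | empty => simpa using IsLittleOP.zero
  | insert a s ha ih =>
    simp only [Finset.sum_insert ha]
    exact (h a (Finset.mem_insert_self a s)).add
      (ih fun i hi => h i (Finset.mem_insert_of_mem hi))

theorem IsBigOP.mul_isLittleOP (hX : IsBigOP ρ X) (hX' : IsLittleOP ρ X') :
    IsLittleOP ρ fun n ω => X n ω * X' n ω := by
  intro ε hε
  rw [ENNReal.tendsto_nhds_zero]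
  intro δ hδ
  have hδ2 : 0 < δ / 2 := ENNReal.half_pos hδ.ne'
  obtain ⟨C, hC⟩ := hX _ hδ2
  have hη : 0 < ε / (C + 1 : ℝ≥0) := ENNReal.div_pos hε.ne' ENNReal.coe_ne_top
  have h2 := ENNReal.tendsto_nhds_zero.1 (hX' _ hη) _ hδ2
  filter_upwards [hC, h2] with n h1 h2
  calc ρ {ω | ε ≤ X n ω * X' n ω}
      ≤ ρ ({ω | (C : ℝ≥0∞) < X n ω} ∪ {ω | ε / (C + 1 : ℝ≥0) ≤ X' n ω}) := by
        refine measure_mono fun ω hω => ?_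
        by_contra hc
        simp only [Set.mem_union, Set.mem_ofPred_eq, not_or, not_le, not_lt] at hc hω
        have h3 : ε ≤ X' n ω * (C + 1 : ℝ≥0) := by
          rw [mul_comm]
          refine hω.trans (mul_le_mul_left (hc.1.trans ?_) _)
          exact_mod_cast (le_add_of_nonneg_right zero_le_one)
        have h4 := ENNReal.div_le_of_le_mul h3
        exact absurd hc.2 (not_lt.2 h4)
    _ ≤ δ / 2 + δ / 2 := (measure_union_le _ _).trans (add_le_add h1 h2)
    _ = δ := ENNReal.add_halves δ

theorem IsLittleOP.mul_isBigOP (hX : IsLittleOP ρ X) (hX' : IsBigOP ρ X') :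
    IsLittleOP ρ fun n ω => X n ω * X' n ω := by
  have h : (fun n ω => X n ω * X' n ω) = fun n ω => X' n ω * X n ω := by
    ext n ω
    exact mul_comm _ _
  rw [h]
  exact hX'.mul_isLittleOP hX

theorem IsLittleOP.of_tendsto {c : ℕ → ℝ≥0∞} (hc : Tendsto c atTop (𝓝 0)) :
    IsLittleOP ρ fun n _ => c n := by
  intro ε hε
  refine tendsto_const_nhds.congr' ?_
  filter_upwards [hc.eventually (gt_mem_nhds hε)] with n hn
  have h : {ω : Ω | ε ≤ c n} = ∅ := by
    ext ω
    simp [hn]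
  rw [h, measure_empty]

theorem IsBigOP.of_ae_bound {C : ℝ≥0} (h : ∀ n, ∀ᵐ ω ∂ρ, X n ω ≤ C) : IsBigOP ρ X := by
  intro δ _
  refine ⟨C, Eventually.of_forall fun n => ?_⟩
  have h0 : ρ {ω | (C : ℝ≥0∞) < X n ω} = 0 := by
    simpa only [ae_iff, not_le] using h n
  rw [h0]
  exact zero_le

theorem IsLittleOP.const_mul (hX : IsLittleOP ρ X) {C : ℝ≥0∞} (hC : C ≠ ∞) :
    IsLittleOP ρ fun n ω => C * X n ω :=
  (IsBigOP.of_ae_bound (X := fun _ _ => C) (C := C.toNNReal)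
    fun _ => ae_of_all _ fun _ => (ENNReal.coe_toNNReal hC).ge).mul_isLittleOP hX

/-- The value ∞ exceeds every constant, so the event X = ∞ has vanishing probability. Adding this
indicator to a bound makes the bound trivial on that event at no cost. -/
theorem IsBigOP.isLittleOP_top_indicator (hX : IsBigOP ρ X) :
    IsLittleOP ρ fun n ω => ({∞} : Set ℝ≥0∞).indicator (fun _ => ∞) (X n ω) := by
  intro ε hε
  rw [ENNReal.tendsto_nhds_zero]
  intro δ hδ
  obtain ⟨C, hC⟩ := hX δ hδ
  filter_upwards [hC] with n hn
  refine (measure_mono fun ω hω => ?_).trans hn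
  by_cases h : X n ω = ∞
  · simp [h]
  · simp [h, hε.ne'] at hω

end StochasticOrders

/-! ### Empirical means of an i.i.d. sample. -/

section Sampling

variable {Ω E : Type*} [MeasurableSpace Ω] [MeasurableSpace E] {ρ : Measure Ω}
  [IsProbabilityMeasure ρ] {P : Measure E} [IsProbabilityMeasure P] {O : ℕ → Ω → E}

/-- Weak convergence in `IsDonsker` is stated under the product law; this carries its consequences
over to the probability space of the observations. -/
theorem measurePreserving_sample (hO : ∀ i, Measurable (O i)) (hindep : iIndepFun O ρ)
    (hlaw : ∀ i, Measure.map (O i) ρ = P) (n : ℕ) :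
    MeasurePreserving (fun ω (j : Fin n) => O j ω) ρ (Measure.pi fun _ => P) := by
  refine ⟨measurable_pi_lambda _ fun j => hO j, ?_⟩
  have h := iIndepFun.map_fun_eq_pi_map (f := fun (j : Fin n) => O j) (μ := ρ)
    (fun j => (hO j).aemeasurable) (hindep.precomp (g := fun j : Fin n => (j : ℕ)) Fin.val_injective)
  simpa only [hlaw] using h

/-- The weak law of large numbers. -/
theorem isLittleOP_empiricalMean_sub (hO : ∀ i, Measurable (O i)) (hindep : iIndepFun O ρ)
    (hlaw : ∀ i, Measure.map (O i) ρ = P) {f : E → ℝ} (hfm : Measurable f) (hf : Integrable f P) :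
    IsLittleOP ρ fun n ω => ‖(∑ j : Fin n, f (O j ω)) / n - ∫ o, f o ∂P‖ₑ := by
  have hae := strong_law_ae_real (μ := ρ) (fun i ω => f (O i ω))
    (by
      have h : Integrable f (Measure.map (O 0) ρ) := by rwa [hlaw 0]
      exact h.comp_measurable (hO 0))
    (fun i j hij => (hindep.indepFun hij).comp hfm hfm)
    (fun i => (IdentDistrib.mk (hO i).aemeasurable (hO 0).aemeasurable
      (by rw [hlaw, hlaw])).comp hfm)
  have hmean : ∫ ω, f (O 0 ω) ∂ρ = ∫ o, f o ∂P := by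
    rw [← hlaw 0, integral_map (hO 0).aemeasurable hfm.aestronglyMeasurable]
  rw [hmean] at hae
  have h := tendstoInMeasure_of_tendsto_ae (μ := ρ) (fun n => by
    refine Measurable.aestronglyMeasurable ?_
    exact (Finset.measurable_sum _ fun i _ => hfm.comp (hO i)).div_const _) hae
  intro ε hε
  have hsum : ∀ (n : ℕ) (ω : Ω), ∑ j : Fin n, f (O j ω) = ∑ i ∈ Finset.range n, f (O i ω) :=
    fun n ω => (Finset.sum_range fun i => f (O i ω)).symm
  simpa only [hsum, edist_eq_enorm_sub] using h ε hε

/-- Markov's inequality for a measurable majorant of T whose integral is below δ. The measurable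
cover s is what can be pulled back along the sample map. -/
theorem meas_one_le_le_of_outerExp_lt {μ : Measure E} [IsProbabilityMeasure μ] {T : E → ℝ}
    (h0 : ∀ x, 0 ≤ T x) (h1 : ∀ x, T x ≤ 1) {δ : ℝ} (h : outerExp μ T < δ) :
    ∃ s, MeasurableSet s ∧ {x | 1 ≤ T x} ⊆ s ∧ μ s ≤ ENNReal.ofReal δ := by
  have hne : {r | ∃ U : E → ℝ, Measurable U ∧ Integrable U μ ∧ (∀ x, T x ≤ U x) ∧
      r = ∫ x, U x ∂μ}.Nonempty :=
    ⟨1, fun _ => 1, measurable_const, integrable_const _, h1, by simp⟩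
  obtain ⟨_, ⟨U, hUm, hUi, hTU, rfl⟩, hr⟩ := exists_lt_of_csInf_lt hne h
  refine ⟨{x | 1 ≤ U x}, measurableSet_le measurable_const hUm, fun x hx => le_trans hx (hTU x), ?_⟩
  have h2 := mul_meas_ge_le_integral_of_nonneg (μ := μ)
    (ae_of_all _ fun x => (h0 x).trans (hTU x)) hUi 1
  rw [one_mul] at h2
  rw [← ofReal_measureReal]
  exact ENNReal.ofReal_le_ofReal (h2.trans hr.le)

/-- Weak convergence to a tight limit forces boundedness in probability: a compact set carrying most
of the limit lies in a ball, and a continuous cutoff detects mass escaping a slightly larger ball.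
-/
theorem IsDonsker.isBigOP_norm {F : Set (E → ℝ)} {Z : ∀ n, (Fin n → E) → lp (fun _ : F => ℝ) ∞}
    (hO : ∀ i, Measurable (O i)) (hindep : iIndepFun O ρ) (hlaw : ∀ i, Measure.map (O i) ρ = P)
    {ν : @Measure (lp (fun _ : F => ℝ) ∞) (borel _)} (hν : ν Set.univ = 1)
    (htight : ∀ ε : ℝ≥0∞, 0 < ε → ∃ K : Set (lp (fun _ : F => ℝ) ∞), IsCompact K ∧ ν Kᶜ ≤ ε)
    (hweak : ∀ H : BoundedContinuousFunction (lp (fun _ : F => ℝ) ∞) ℝ,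
        Tendsto (fun n => outerExp (Measure.pi fun _ : Fin n => P) fun x => H (Z n x)) atTop
          (𝓝 (∫ z, H z ∂ν))) :
    IsBigOP ρ fun n ω => ‖Z n fun j => O j ω‖ₑ := by
  let : MeasurableSpace (lp (fun _ : F => ℝ) ∞) := borel _
  have : BorelSpace (lp (fun _ : F => ℝ) ∞) := ⟨rfl⟩
  have : IsProbabilityMeasure ν := ⟨hν⟩
  intro δ hδ
  -- δ may be ∞, hence the minimum with 1.
  obtain ⟨η, hη, hηδ⟩ : ∃ η : ℝ, 0 < η ∧ ENNReal.ofReal η ≤ δ := by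
    refine ⟨(min δ 1).toReal, ENNReal.toReal_pos (by simp [hδ.ne']) (by simp), ?_⟩
    rw [ENNReal.ofReal_toReal (by simp)]
    exact min_le_left _ _
  obtain ⟨K, hK, hνK⟩ := htight (ENNReal.ofReal (η / 2)) (by simpa using hη)
  obtain ⟨M, hM0, hM⟩ := hK.isBounded.exists_pos_norm_le
  -- The cutoff is 0 on the ball of radius M, which contains K, and 1 from radius M + 1 on.
  let H : BoundedContinuousFunction (lp (fun _ : F => ℝ) ∞) ℝ :=
    BoundedContinuousFunction.ofNormedAddCommGroup (fun z => min 1 (max 0 (‖z‖ - M)))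
      (by fun_prop) 1 (fun z => by
        rw [Real.norm_eq_abs, abs_of_nonneg (le_min zero_le_one (le_max_left _ _))]
        exact min_le_left _ _)
  have hH : ∀ z, H z = min 1 (max 0 (‖z‖ - M)) := fun _ => rfl
  have hHν : ∫ z, H z ∂ν < η := by
    have hKm : MeasurableSet Kᶜ := hK.isClosed.measurableSet.compl
    calc ∫ z, H z ∂ν ≤ ∫ z, Kᶜ.indicator 1 z ∂ν := by
          refine integral_mono (H.integrable ν) ((integrable_const (1 : ℝ)).indicator hKm) fun z => ?_
          by_cases hz : z ∈ K
          · simp [hH, hz, hM z hz]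
          · simp [hH, hz]
      _ = ν.real Kᶜ := integral_indicator_one hKm
      _ ≤ η / 2 := ENNReal.toReal_le_of_le_ofReal (by positivity) hνK
      _ < η := half_lt_self hη
  refine ⟨(M + 1).toNNReal, ?_⟩
  filter_upwards [(hweak H).eventually (gt_mem_nhds hHν)] with n hn
  obtain ⟨s, hs, hsub, hle⟩ := meas_one_le_le_of_outerExp_lt
    (fun x => by rw [hH]; exact le_min zero_le_one (le_max_left _ _))
    (fun x => by rw [hH]; exact min_le_left _ _) hn
  refine le_trans ?_ (hle.trans hηδ)
  rw [← (measurePreserving_sample hO hindep hlaw n).measure_preimage hs.nullMeasurableSet]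
  refine measure_mono fun ω hω => hsub ?_
  have h : M + 1 < ‖Z n fun j => O j ω‖ := by
    rw [Set.mem_ofPred_eq, ← ofReal_norm, ← ENNReal.ofReal] at hω
    exact (ENNReal.ofReal_lt_ofReal_iff_of_nonneg (by positivity)).1 hω
  change 1 ≤ H (Z n fun j => O j ω)
  rw [hH]
  exact le_min le_rfl (le_max_of_le_right (by linarith))

/-- Uniform law of large numbers in probability over a Donsker class. -/
theorem IsDonsker.isLittleOP_empiricalMean_sub {F : Set (E → ℝ)} (hF : IsDonsker P F)
    (hO : ∀ i, Measurable (O i)) (hindep : iIndepFun O ρ) (hlaw : ∀ i, Measure.map (O i) ρ = P)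
    {f : ℕ → Ω → E → ℝ} (hf : ∀ n, ∀ᵐ ω ∂ρ, f n ω ∈ F) :
    IsLittleOP ρ fun n ω => ‖(∑ j : Fin n, f n ω (O j ω)) / n - ∫ o, f n ω o ∂P‖ₑ := by
  obtain ⟨Z, hZ, ν, hν, htight, hweak⟩ := hF.weak
  have hbig := IsDonsker.isBigOP_norm hO hindep hlaw hν htight hweak
  have hsmall : Tendsto (fun n : ℕ => ENNReal.ofReal (√(n : ℝ))⁻¹) atTop (𝓝 0) := by
    rw [← ENNReal.ofReal_zero]
    exact ENNReal.tendsto_ofReal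
      (tendsto_inv_atTop_zero.comp (Real.tendsto_sqrt_atTop.comp tendsto_natCast_atTop_atTop))
  -- The supremum over F of the empirical process bounds its value at the random index f n ω;
  -- dividing by √n gives o_P(1).
  refine (hbig.mul_isLittleOP (IsLittleOP.of_tendsto hsmall)).mono_ae ?_
  filter_upwards [eventually_gt_atTop 0] with n hn
  filter_upwards [hf n] with ω hω
  have hs : 0 < √(n : ℝ) := Real.sqrt_pos.2 (by exact_mod_cast hn)
  have h1 := lp.norm_apply_le_norm (p := ∞) (by simp) (Z n fun j => O j ω) ⟨f n ω, hω⟩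
  rw [hZ, empProc, norm_mul, Real.norm_of_nonneg hs.le] at h1
  rw [← ofReal_norm, ← ofReal_norm, ← ENNReal.ofReal_mul (norm_nonneg _)]
  refine ENNReal.ofReal_le_ofReal ?_
  rw [← div_eq_mul_inv, le_div_iff₀ hs, mul_comm]
  exact h1

end Sampling

namespace Design

variable {V : Type*} [Fintype V] [LinearOrder V] [SuccOrder V]
  {S : V → Type*} [∀ v, MeasurableSpace (S v)] {D : Design V S}

/-! ### The order of the vertices -/

theorem mem_Z {v : V} : v ∈ D.Z ↔ D.A < v ∧ v ≠ D.Y := by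
  simp [Z]

theorem Admissible.A_lt_Y (hD : D.Admissible) : D.A < D.Y :=
  lt_of_le_of_ne (hD.last _) hD.ne

theorem isMax_iff_of_last (hlast : ∀ v, v ≤ D.Y) {v : V} : IsMax v ↔ v = D.Y :=
  ⟨fun h => le_antisymm (hlast v) (h (hlast v)), fun h _ _ => h ▸ hlast _⟩

theorem Admissible.A_lt_Z₁ (hD : D.Admissible) : D.A < D.Z₁ :=
  Order.lt_succ_of_not_isMax fun h => hD.ne ((isMax_iff_of_last hD.last).1 h)

theorem Z₁_le_iff (hD : D.Admissible) {v : V} : D.Z₁ ≤ v ↔ D.A < v :=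
  Order.succ_le_iff_of_not_isMax fun h => hD.ne ((isMax_iff_of_last hD.last).1 h)

theorem not_isMax_of_mem_Z (hD : D.Admissible) {v : V} (hv : v ∈ D.Z) : ¬ IsMax v :=
  fun h => (mem_Z.1 hv).2 ((isMax_iff_of_last hD.last).1 h)

theorem lt_succ_iff_of_mem_Z (hD : D.Admissible) {u v : V} (hv : v ∈ D.Z) :
    u < Order.succ v ↔ u ≤ v :=
  Order.lt_succ_iff_of_not_isMax (not_isMax_of_mem_Z hD hv)

theorem A_lt_succ (hD : D.Admissible) {v : V} (hv : v ∈ D.Z) : D.A < Order.succ v :=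
  (mem_Z.1 hv).1.trans (Order.lt_succ_of_not_isMax (not_isMax_of_mem_Z hD hv))

/-- Induction along the post-treatment vertices. -/
theorem postTreatment_induction (hD : D.Admissible) {p : V → Prop} (first : p D.Z₁)
    (step : ∀ v ∈ D.Z, p v → p (Order.succ v)) {v : V} (hv : D.A < v) : p v := by
  have h : D.Z₁ ≤ v := (Z₁_le_iff hD).2 hv
  induction h using Succ.rec with
  | rfl => exact first
  | succ n hn ih =>
    have hAn := (Z₁_le_iff hD).1 hn
    by_cases hY : n = D.Y
    -- `Order.succ` fixes the last vertex, so nothing new is claimed beyond Y.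
    · rw [Order.succ_eq_iff_isMax.2 ((isMax_iff_of_last hD.last).2 hY)]
      exact ih hAn
    · exact step n (mem_Z.2 ⟨hAn, hY⟩) (ih hAn)

theorem filter_lt_succ (hD : D.Admissible) {v : V} (hv : v ∈ D.Z) :
    (D.Z.filter fun i => i < Order.succ v) = insert v (D.Z.filter fun i => i < v) := by
  ext i
  simp only [Finset.mem_filter, Finset.mem_insert, lt_succ_iff_of_mem_Z hD hv, le_iff_lt_or_eq]
  constructor
  · rintro ⟨h1, h2 | h2⟩
    · exact Or.inr ⟨h1, h2⟩
    · exact Or.inl h2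
  · rintro (rfl | ⟨h1, h2⟩)
    · exact ⟨hv, Or.inr rfl⟩
    · exact ⟨h1, Or.inl h2⟩

theorem filter_lt_Z₁ (hD : D.Admissible) : (D.Z.filter fun i => i < D.Z₁) = ∅ := by
  refine Finset.filter_eq_empty_iff.2 fun i hi h => ?_
  exact absurd h (not_lt.2 ((Z₁_le_iff hD).2 (mem_Z.1 hi).1))

theorem sum_succ_sub (hD : D.Admissible) (f : V → ℝ) :
    ∑ v ∈ D.Z, (f (Order.succ v) - f v) = f D.Y - f D.Z₁ := by
  have h : ∀ w, D.A < w →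
      ∑ v ∈ D.Z.filter (fun i => i < w), (f (Order.succ v) - f v) = f w - f D.Z₁ := by
    intro w hw
    refine postTreatment_induction hD
      (p := fun w => ∑ v ∈ D.Z.filter (fun i => i < w), (f (Order.succ v) - f v) = f w - f D.Z₁)
      ?_ (fun v hv ih => ?_) hw
    · rw [filter_lt_Z₁ hD, Finset.sum_empty, sub_self]
    · rw [filter_lt_succ hD hv, Finset.sum_insert (by simp), ih]
      ring
  rw [← h _ hD.A_lt_Y]
  congr 1
  exact (Finset.filter_true_of_mem fun v hv =>
    lt_of_le_of_ne (hD.last v) (mem_Z.1 hv).2).symm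

/-! ### Levels and Markov pillows -/

/-- A directed path from A to Z₁ starts with an edge A → c, and A < c ≤ Z₁ leaves only c = Z₁.
Primal fixability then puts Z₁ in 𝓜, so that a_{Z₁} = a₀. -/
theorem dir_A_Z₁ (hD : D.Admissible) : D.G.dir D.A D.Z₁ := by
  have hle : ∀ {u w : V}, Relation.ReflTransGen D.G.dir u w → u ≤ w := by
    intro u w h
    induction h with
    | refl => exact le_rfl
    | tail _ h ih => exact ih.trans (hD.topological _ _ h).le
  rcases (hD.descendants _ hD.A_lt_Z₁).cases_head with h | ⟨c, hc, hcZ⟩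
  · exact absurd h hD.A_lt_Z₁.ne
  · rwa [le_antisymm (hle hcZ) ((Z₁_le_iff hD).2 (hD.topological _ _ hc))] at hc

theorem Z₁_mem_M (hD : D.Admissible) : D.Z₁ ∈ D.M :=
  ⟨hD.A_lt_Z₁, Set.disjoint_left.1 hD.primalFixable (dir_A_Z₁ hD)⟩

theorem mem_M_iff {v : V} (hv : D.A < v) : v ∈ D.M ↔ v ∉ D.L := by
  simp [M, L, hv, hv.le]

theorem Z₁_notMem_L (hD : D.Admissible) : D.Z₁ ∉ D.L :=
  (mem_M_iff hD.A_lt_Z₁).1 (Z₁_mem_M hD)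

theorem lvl_Z₁ (hD : D.Admissible) : D.lvl D.Z₁ = D.a₀ :=
  if_neg (Z₁_notMem_L hD)

theorem lvl_eq_lvl_iff {u v : V} : D.lvl u = D.lvl v ↔ (u ∈ D.L ↔ v ∈ D.L) := by
  by_cases hu : u ∈ D.L <;> by_cases hv : v ∈ D.L <;> simp [lvl, hu, hv, a₁]

theorem mpA_eq (hNP : D.Nonparametric) {v : V} (hv : D.A < v) :
    D.mpA v = {u | u < v ∧ u ≠ D.A} := by
  rw [mpA, hNP v hv.le]
  rfl

theorem mpA_Z₁ (hD : D.Admissible) (hNP : D.Nonparametric) :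
    D.mpA D.Z₁ = D.G.markovPillow D.A := by
  rw [mpA_eq hNP hD.A_lt_Z₁, hNP _ le_rfl]
  ext u
  have h : u < D.Z₁ ↔ u ≤ D.A :=
    Order.lt_succ_iff_of_not_isMax fun h => hD.ne ((isMax_iff_of_last hD.last).1 h)
  simp only [Set.mem_ofPred_eq, h]
  exact lt_iff_le_and_ne.symm

/-- Thus h at v and g at the next vertex condition on the same variables, and the regression error
at the next vertex can be paired with the error of h at v. -/
theorem mpA_succ (hD : D.Admissible) (hNP : D.Nonparametric) {v : V} (hv : v ∈ D.Z) :
    D.mpA (Order.succ v) = insert v (D.mpA v) := by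
  have hA := (mem_Z.1 hv).1
  rw [mpA_eq hNP (A_lt_succ hD hv), mpA_eq hNP hA]
  ext u
  simp only [Set.mem_ofPred_eq, Set.mem_insert_iff, lt_succ_iff_of_mem_Z hD hv, le_iff_lt_or_eq]
  constructor
  · rintro ⟨h | h, h'⟩
    · exact Or.inr ⟨h, h'⟩
    · exact Or.inl h
  · rintro (rfl | ⟨h, h'⟩)
    · exact ⟨Or.inr rfl, hA.ne'⟩
    · exact ⟨Or.inl h, h'⟩

theorem mpA_subset (hNP : D.Nonparametric) {u v : V} (hu : D.A < u) (huv : u ≤ v) :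
    D.mpA u ⊆ D.mpA v := by
  rw [mpA_eq hNP hu, mpA_eq hNP (hu.trans_le huv)]
  exact fun w hw => ⟨hw.1.trans_le huv, hw.2⟩

theorem insert_mpA_subset (hNP : D.Nonparametric) {u v : V} (hu : D.A < u) (huv : u < v) :
    insert u (D.mpA u) ⊆ D.mpA v :=
  Set.insert_subset (by rw [mpA_eq hNP (hu.trans huv)]; exact ⟨huv, hu.ne'⟩)
    (mpA_subset hNP hu huv.le)

theorem sig_le (s : Set V) : D.sig s ≤ MeasurableSpace.pi :=
  (Set.measurable_restrict s).comap_le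

theorem sig_mono {s t : Set V} (h : s ⊆ t) : D.sig s ≤ D.sig t := by
  have h2 : s.domRestrict (π := S) = Set.domRestrict₂ h ∘ t.domRestrict := rfl
  rw [sig, sig, h2, ← MeasurableSpace.comap_comp]
  exact MeasurableSpace.comap_mono (Set.measurable_restrict₂ h).comap_le

/-! ### The treatment indicators and the outcome -/

theorem measurableSet_trtEq (a : Bool) : MeasurableSet (D.trtEq a) :=
  (D.trt.measurable.comp (measurable_pi_apply D.A)) (measurableSet_singleton a)

theorem measurable_y : Measurable D.y :=
  D.out.measurable.comp (measurable_pi_apply D.Y)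

theorem measurable_ind (a : Bool) : Measurable (D.ind a) :=
  measurable_one.indicator (measurableSet_trtEq a)

theorem abs_ind_le (a : Bool) (o : ∀ v, S v) : |D.ind a o| ≤ 1 := by
  by_cases h : o ∈ D.trtEq a <;> simp [ind, h]

theorem ind_eq_one_sub {a b : Bool} (h : a ≠ b) (o : ∀ v, S v) : D.ind a o = 1 - D.ind b o := by
  by_cases ha : D.trt (o D.A) = a
  · have hb : D.trt (o D.A) ≠ b := ha ▸ h
    simp [ind, trtEq, ha, h]
  · have hb : D.trt (o D.A) = b := by
      revert ha h
      cases D.trt (o D.A) <;> cases a <;> cases b <;> simp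
    simp [ind, trtEq, hb, h.symm]

theorem integrable_ind (P : Measure (∀ v, S v)) [IsFiniteMeasure P] (a : Bool) :
    Integrable (D.ind a) P :=
  Integrable.of_bound (measurable_ind a).aestronglyMeasurable 1 (ae_of_all _ (abs_ind_le a))

/-! ### Weights -/

namespace Nuisance

variable (Q : D.Nuisance)

open Classical in
/-- The product of the ratios of the mediators in `𝓜` that precede `v`. -/
noncomputable def weightL (v : V) (o : ∀ v, S v) : ℝ := ∏ i ∈ D.Z with i ∈ D.M ∧ i < v, Q.ratio i o

open Classical in
/-- The product of the treatment ratio and the ratios of the mediators in `𝓛` that precede `v`. -/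
noncomputable def weightM (v : V) (o : ∀ v, S v) : ℝ :=
  Q.ratioA o * ∏ i ∈ D.Z with i ∈ D.L ∧ i < v, Q.ratio i o

theorem R_of_mem_L {v : V} (hv : v ∈ D.L) : Q.R v = Q.weightL v := by
  ext o
  exact if_pos hv

theorem R_of_notMem_L {v : V} (hv : v ∉ D.L) : Q.R v = Q.weightM v := by
  ext o
  exact if_neg hv

open Classical in
theorem _root_.Design.prod_lt_succ (hD : D.Admissible) (p : V → Prop) (f : V → ℝ) {v : V}
    (hv : v ∈ D.Z) : ∏ i ∈ D.Z with p i ∧ i < Order.succ v, f i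
      = (∏ i ∈ D.Z with p i ∧ i < v, f i) * if p v then f v else 1 := by
  have h : ∀ w, (D.Z.filter fun i => p i ∧ i < w) = (D.Z.filter fun i => i < w).filter p := by
    intro w
    rw [Finset.filter_filter]
    exact Finset.filter_congr fun i _ => and_comm
  rw [h, h, filter_lt_succ hD hv, Finset.filter_insert]
  split_ifs with hp
  · rw [Finset.prod_insert (by simp), mul_comm]
  · rw [mul_one]

open Classical in
theorem weightL_succ (hD : D.Admissible) {v : V} (hv : v ∈ D.Z) (o : ∀ v, S v) :
    Q.weightL (Order.succ v) o = Q.weightL v o * if v ∈ D.L then 1 else Q.ratio v o := by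
  rw [weightL, prod_lt_succ hD (fun i => i ∈ D.M) (fun i => Q.ratio i o) hv]
  by_cases h : v ∈ D.L <;> simp [weightL, mem_M_iff (mem_Z.1 hv).1, h]

open Classical in
theorem weightM_succ (hD : D.Admissible) {v : V} (hv : v ∈ D.Z) (o : ∀ v, S v) :
    Q.weightM (Order.succ v) o = Q.weightM v o * if v ∈ D.L then Q.ratio v o else 1 := by
  rw [weightM, prod_lt_succ hD (fun i => i ∈ D.L) (fun i => Q.ratio i o) hv, weightM, mul_assoc]

open Classical in
theorem weightL_Z₁ (hD : D.Admissible) (o : ∀ v, S v) : Q.weightL D.Z₁ o = 1 := by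
  rw [weightL]
  refine Finset.prod_eq_one fun i hi => absurd (Finset.mem_filter.1 hi).2.2 ?_
  exact not_lt.2 ((Z₁_le_iff hD).2 (mem_Z.1 (Finset.mem_filter.1 hi).1).1)

open Classical in
theorem weightM_Z₁ (hD : D.Admissible) (o : ∀ v, S v) : Q.weightM D.Z₁ o = Q.ratioA o := by
  rw [weightM, Finset.prod_eq_one, mul_one]
  refine fun i hi => absurd (Finset.mem_filter.1 hi).2.2 ?_
  exact not_lt.2 ((Z₁_le_iff hD).2 (mem_Z.1 (Finset.mem_filter.1 hi).1).1)

/-- Uniform positivity and coherence at a point of the sample space. -/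
structure RegularAt (ε : ℝ) (o : ∀ v, S v) : Prop where
  first : Q.g D.Z₁ o ∈ Set.Icc ε (1 - ε)
  g_mem : ∀ v ∈ D.Z, Q.g v o ∈ Set.Icc ε (1 - ε)
  h_mem : ∀ v ∈ D.Z, Q.h v o ∈ Set.Icc ε (1 - ε)
  coherent : ∀ v ∈ D.Z, Order.succ v ∈ D.Z →
    Q.g (Order.succ v) o = if D.lvl (Order.succ v) = D.lvl v then Q.h v o else 1 - Q.h v o

variable {Q}

theorem Positive.regularAt {P : Measure (∀ v, S v)} {ε : ℝ} (hpos : Q.Positive P ε)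
    (hcoh : Q.Coherent P) : ∀ᵐ o ∂P, Q.RegularAt ε o := by
  have h1 := (ae_ball_iff (Finset.countable_toSet D.Z)).2 hpos.2
  have h2 : ∀ᵐ o ∂P, ∀ v ∈ D.Z, Order.succ v ∈ D.Z →
      Q.g (Order.succ v) o = if D.lvl (Order.succ v) = D.lvl v then Q.h v o else 1 - Q.h v o := by
    refine (ae_ball_iff (Finset.countable_toSet D.Z)).2 fun v hv => ?_
    by_cases hs : Order.succ v ∈ D.Z
    · filter_upwards [hcoh v hv hs] with o ho _ using ho
    · exact ae_of_all _ fun _ h => absurd h hs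
  filter_upwards [hpos.1, h1, h2] with o ho1 ho2 ho3
  exact ⟨ho1, fun v hv => (ho2 v hv).1, fun v hv => (ho2 v hv).2, ho3⟩

open Classical in
/-- The odds of the treatment given the past of `v`, read off from `g_v`, connect the two weights at
`v`. -/
theorem RegularAt.weightM_mul (hD : D.Admissible) {ε : ℝ} (hε : 0 < ε) {o : ∀ v, S v}
    (ho : Q.RegularAt ε o) {v : V} (hv : v ∈ D.Z) :
    Q.weightM v o * (if v ∈ D.L then 1 - Q.g v o else Q.g v o)
        = Q.weightL v o * (if v ∈ D.L then Q.g v o else 1 - Q.g v o) ∧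
      Q.weightM (Order.succ v) o * (if v ∈ D.L then 1 - Q.h v o else Q.h v o)
        = Q.weightL (Order.succ v) o * (if v ∈ D.L then Q.h v o else 1 - Q.h v o) := by
  -- Passing v multiplies exactly one of the two weights by f^r_v, which trades the odds from g_v
  -- for the odds from h_v.
  have hstep : ∀ v ∈ D.Z, Q.weightM v o * (if v ∈ D.L then 1 - Q.g v o else Q.g v o)
        = Q.weightL v o * (if v ∈ D.L then Q.g v o else 1 - Q.g v o) →
      Q.weightM (Order.succ v) o * (if v ∈ D.L then 1 - Q.h v o else Q.h v o)
        = Q.weightL (Order.succ v) o * (if v ∈ D.L then Q.h v o else 1 - Q.h v o) := by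
    intro v hv h
    have hg := ho.g_mem v hv
    have hh := ho.h_mem v hv
    have hg0 : Q.g v o ≠ 0 := (hε.trans_le hg.1).ne'
    have hh1 : 1 - Q.h v o ≠ 0 := by linarith [hh.2]
    rw [weightM_succ Q hD hv, weightL_succ Q hD hv, ratio]
    by_cases hL : v ∈ D.L
    · simp only [hL, if_true] at h ⊢
      field_simp
      linear_combination Q.h v o * h
    · simp only [hL, if_false] at h ⊢
      field_simp
      linear_combination Q.h v o * h
  have hpre : v ∈ D.Z → Q.weightM v o * (if v ∈ D.L then 1 - Q.g v o else Q.g v o)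
        = Q.weightL v o * (if v ∈ D.L then Q.g v o else 1 - Q.g v o) := by
    refine postTreatment_induction hD (p := fun v => v ∈ D.Z →
      Q.weightM v o * (if v ∈ D.L then 1 - Q.g v o else Q.g v o)
        = Q.weightL v o * (if v ∈ D.L then Q.g v o else 1 - Q.g v o)) (fun _ => ?_)
      (fun v hv ih hs => ?_) (mem_Z.1 hv).1
    · have hg0 : Q.g D.Z₁ o ≠ 0 := (hε.trans_le ho.first.1).ne'
      rw [weightM_Z₁ Q hD, weightL_Z₁ Q hD, ratioA, if_neg (Z₁_notMem_L hD),
        if_neg (Z₁_notMem_L hD), div_mul_cancel₀ _ hg0, one_mul]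
    -- Coherence turns the odds from h_v into the odds from g at the next vertex.
    · have h := hstep v hv (ih hv)
      have hc := ho.coherent v hv hs
      simp only [lvl_eq_lvl_iff] at hc
      by_cases h1 : v ∈ D.L <;> by_cases h2 : Order.succ v ∈ D.L <;>
        simp only [h1, h2, if_true, if_false, iff_self, iff_true, iff_false, not_true] at hc h ⊢ <;> rw [hc] <;> linarith
  exact ⟨hpre hv, hstep v hv (hpre hv)⟩

theorem RegularAt.R_succ_of_lvl_eq (hD : D.Admissible) {o : ∀ v, S v} {v : V} (hv : v ∈ D.Z)
    (h : D.lvl (Order.succ v) = D.lvl v) : Q.R (Order.succ v) o = Q.R v o := by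
  rw [lvl_eq_lvl_iff] at h
  by_cases h1 : v ∈ D.L
  · rw [R_of_mem_L Q h1, R_of_mem_L Q (h.2 h1), weightL_succ Q hD hv, if_pos h1, mul_one]
  · rw [R_of_notMem_L Q h1, R_of_notMem_L Q (mt h.1 h1), weightM_succ Q hD hv, if_neg h1, mul_one]

/-- The weight on the side of v is not altered at v, so 𝓡_v and 𝓡_{v+1} are the two weights at v +
1. The odds relation `weightM_mul` then gives 𝓡_{v+1}(1 − h_v) = 𝓡_v h_v. -/
theorem RegularAt.R_succ_of_lvl_ne (hD : D.Admissible) {ε : ℝ} (hε : 0 < ε) {o : ∀ v, S v}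
    (ho : Q.RegularAt ε o) {v : V} (hv : v ∈ D.Z) (h : D.lvl (Order.succ v) ≠ D.lvl v) :
    Q.R (Order.succ v) o = Q.h v o * (Q.R v o + Q.R (Order.succ v) o) := by
  rw [Ne, lvl_eq_lvl_iff] at h
  have hb := (ho.weightM_mul hD hε hv).2
  by_cases h1 : v ∈ D.L
  · have h2 : Order.succ v ∉ D.L := fun h2 => h (iff_of_true h2 h1)
    have h3 : Q.weightL v o = Q.weightL (Order.succ v) o := by
      rw [weightL_succ Q hD hv, if_pos h1, mul_one]
    rw [R_of_mem_L Q h1, R_of_notMem_L Q h2, h3]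
    simp only [h1, if_true] at hb
    linarith
  · have h2 : Order.succ v ∈ D.L := by
      by_contra h2
      exact h (iff_of_false h2 h1)
    have h3 : Q.weightM v o = Q.weightM (Order.succ v) o := by
      rw [weightM_succ Q hD hv, if_neg h1, mul_one]
    rw [R_of_notMem_L Q h1, R_of_mem_L Q h2, h3]
    simp only [h1, if_false] at hb
    linarith

theorem R_Z₁ (hD : D.Admissible) (o : ∀ v, S v) : Q.R D.Z₁ o = Q.ratioA o := by
  rw [R_of_notMem_L Q (Z₁_notMem_L hD), weightM_Z₁ Q hD]

theorem RegularAt.ratioA_mem {ε : ℝ} (hε : 0 < ε) {o : ∀ v, S v} (ho : Q.RegularAt ε o) :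
    Q.ratioA o ∈ Set.Icc 0 ε⁻¹ := by
  have h := ho.first
  have hg : 0 < Q.g D.Z₁ o := hε.trans_le h.1
  refine ⟨div_nonneg (by linarith [h.2]) hg.le, ?_⟩
  rw [ratioA, inv_eq_one_div]
  exact div_le_div₀ zero_le_one (by linarith) hε h.1

theorem RegularAt.ratio_mem {ε : ℝ} (hε : 0 < ε) {o : ∀ v, S v} (ho : Q.RegularAt ε o)
    {v : V} (hv : v ∈ D.Z) : Q.ratio v o ∈ Set.Icc 0 (ε⁻¹ * ε⁻¹) := by
  have hg := ho.g_mem v hv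
  have hh := ho.h_mem v hv
  have h0 : 0 < Q.g v o := hε.trans_le hg.1
  have h1 : 0 < Q.h v o := hε.trans_le hh.1
  have h2 : 0 ≤ (1 - Q.g v o) / Q.g v o := div_nonneg (by linarith [hg.2]) h0.le
  have h3 : 0 ≤ Q.h v o / (1 - Q.h v o) := div_nonneg h1.le (by linarith [hh.2])
  refine ⟨mul_nonneg h3 h2, ?_⟩
  rw [ratio, inv_eq_one_div]
  exact mul_le_mul (div_le_div₀ zero_le_one (by linarith [hh.2]) hε (by linarith [hh.2]))
    (div_le_div₀ zero_le_one (by linarith) hε hg.1) h2 (by positivity)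

variable (V) in
/-- A uniform bound for the weights under positivity with constant `ε`. -/
noncomputable def weightBound (ε : ℝ) : ℝ := ε⁻¹ * (ε⁻¹ * ε⁻¹) ^ Fintype.card V

theorem RegularAt.one_le_inv {ε : ℝ} (hε : 0 < ε) {o : ∀ v, S v} (ho : Q.RegularAt ε o) :
    1 ≤ ε⁻¹ := by
  have h := ho.first
  exact (one_le_inv₀ hε).2 (by linarith [h.1, h.2])

theorem RegularAt.prod_ratio_le {ε : ℝ} (hε : 0 < ε) {o : ∀ v, S v} (ho : Q.RegularAt ε o)
    {s : Finset V} (hs : s ⊆ D.Z) :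
    ∏ i ∈ s, Q.ratio i o ∈ Set.Icc 0 ((ε⁻¹ * ε⁻¹) ^ Fintype.card V) := by
  have h1 := ho.one_le_inv hε
  refine ⟨Finset.prod_nonneg fun i hi => (ho.ratio_mem hε (hs hi)).1, ?_⟩
  refine (Finset.prod_le_prod (fun i hi => (ho.ratio_mem hε (hs hi)).1)
    fun i hi => (ho.ratio_mem hε (hs hi)).2).trans ?_
  rw [Finset.prod_const]
  exact pow_le_pow_right₀ (one_le_mul_of_one_le_of_one_le h1 h1) (Finset.card_le_univ s)

theorem RegularAt.abs_R_le {ε : ℝ} (hε : 0 < ε) {o : ∀ v, S v} (ho : Q.RegularAt ε o) (v : V) :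
    |Q.R v o| ≤ weightBound V ε := by
  classical
  by_cases hv : v ∈ D.L
  · have h := ho.prod_ratio_le hε (Finset.filter_subset (fun i => i ∈ D.M ∧ i < v) D.Z)
    rw [R_of_mem_L Q hv, weightL, weightBound]
    rw [abs_of_nonneg (by convert h.1)]
    refine le_trans ?_ (le_mul_of_one_le_left (h.1.trans h.2) (ho.one_le_inv hε))
    convert h.2
  · have h := ho.prod_ratio_le hε (Finset.filter_subset (fun i => i ∈ D.L ∧ i < v) D.Z)
    have hA := ho.ratioA_mem hε
    rw [R_of_notMem_L Q hv, weightM, weightBound, abs_mul, abs_of_nonneg hA.1,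
      abs_of_nonneg (by convert h.1)]
    refine mul_le_mul hA.2 ?_ ?_ (inv_nonneg.2 hε.le)
    · convert h.2
    · convert h.1

theorem measurable_ratio (hNP : D.Nonparametric) {u v : V} (hu : D.A < u) (huv : u < v) :
    Measurable[D.sig (D.mpA v)] (Q.ratio u) := by
  have hh := (Q.measurable_h u).mono (sig_mono (insert_mpA_subset hNP hu huv)) le_rfl
  have hg := (Q.measurable_g u).mono (sig_mono (mpA_subset hNP hu huv.le)) le_rfl
  exact (hh.div (hh.const_sub 1)).mul ((hg.const_sub 1).div hg)

theorem measurable_ratioA (hD : D.Admissible) (hNP : D.Nonparametric) {v : V} (hv : D.A < v) :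
    Measurable[D.sig (D.mpA v)] Q.ratioA := by
  have hg := (Q.measurable_g D.Z₁).mono
    (sig_mono (mpA_subset hNP hD.A_lt_Z₁ ((Z₁_le_iff hD).2 hv))) le_rfl
  exact (hg.const_sub 1).div hg

/-- Only ratios of vertices before v enter, and none depends on A. Hence the weight can be pulled
out of the regression at v. -/
theorem measurable_R (hD : D.Admissible) (hNP : D.Nonparametric) {v : V} (hv : D.A < v) :
    Measurable[D.sig (D.mpA v)] (Q.R v) := by
  classical
  by_cases h : v ∈ D.L
  · rw [R_of_mem_L Q h]
    refine Finset.measurable_fun_prod _ fun i hi => ?_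
    have hi := Finset.mem_filter.1 hi
    exact measurable_ratio hNP (mem_Z.1 hi.1).1 hi.2.2
  · rw [R_of_notMem_L Q h]
    refine (measurable_ratioA hD hNP hv).mul (Finset.measurable_fun_prod _ fun i hi => ?_)
    have hi := Finset.mem_filter.1 hi
    exact measurable_ratio hNP (mem_Z.1 hi.1).1 hi.2.2

end Nuisance

end Design

namespace Design

variable {V : Type*} [Fintype V] [LinearOrder V] [SuccOrder V]
  {S : V → Type*} [∀ v, MeasurableSpace (S v)] {D : Design V S}
  {P : Measure (∀ v, S v)}

/-! ### The true nuisance functions -/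

theorem seqReg_Y (hD : D.Admissible) :
    D.seqReg P D.Y = (P[|D.trtEq (D.lvl D.Y)])[D.y | D.sig (D.mpA D.Y)] := by
  rw [seqReg, backward_eq, if_pos ((isMax_iff_of_last hD.last).2 rfl)]

theorem seqReg_of_mem_Z (hD : D.Admissible) {v : V} (hv : v ∈ D.Z) :
    D.seqReg P v = (P[|D.trtEq (D.lvl v)])[D.seqReg P (Order.succ v) | D.sig (D.mpA v)] := by
  rw [seqReg, backward_eq, if_neg (not_isMax_of_mem_Z hD hv)]

theorem stronglyMeasurable_seqReg (v : V) :
    StronglyMeasurable[D.sig (D.mpA v)] (D.seqReg P v) :=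
  ((D.trueQ P).measurable_B v).stronglyMeasurable

theorem trueG_succ [IsProbabilityMeasure P] (hD : D.Admissible) (hNP : D.Nonparametric) {v : V}
    (hv : v ∈ D.Z) : ∀ᵐ o ∂P, D.trueG P (Order.succ v) o =
      if D.lvl (Order.succ v) = D.lvl v then D.trueH P v o else 1 - D.trueH P v o := by
  rw [trueG, mpA_succ hD hNP hv]
  by_cases h : D.lvl (Order.succ v) = D.lvl v
  · rw [h]
    exact ae_of_all _ fun o => by rw [if_pos rfl]; rfl
  · have h1 : D.ind (D.lvl (Order.succ v)) = (fun _ => (1 : ℝ)) - D.ind (D.lvl v) :=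
      funext (ind_eq_one_sub h)
    rw [h1]
    filter_upwards [condExp_sub (integrable_const (1 : ℝ)) (integrable_ind P (D.lvl v))
      (D.sig (insert v (D.mpA v)))] with o ho
    rw [ho, if_neg h, Pi.sub_apply, condExp_const (sig_le _)]
    rfl

theorem coherent_trueQ [IsProbabilityMeasure P] (hD : D.Admissible) (hNP : D.Nonparametric) :
    (D.trueQ P).Coherent P :=
  fun _ hv _ => trueG_succ hD hNP hv

/-- Positivity is assumed at Z₁ and on 𝓩. At Y, when 𝓩 is nonempty, the bound comes from h at the
preceding vertex. -/
theorem le_trueG [IsProbabilityMeasure P] (hD : D.Admissible) (hNP : D.Nonparametric) {ε : ℝ}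
    (hpos : (D.trueQ P).Positive P ε) {v : V} (hv : D.A < v) : ∀ᵐ o ∂P, ε ≤ D.trueG P v o := by
  refine postTreatment_induction hD (p := fun v => ∀ᵐ o ∂P, ε ≤ D.trueG P v o) ?_
    (fun v hv _ => ?_) hv
  · exact hpos.1.mono fun o ho => ho.1
  · filter_upwards [trueG_succ hD hNP hv, hpos.2 v hv] with o h1 h2
    have h3 : D.trueH P v o ∈ Set.Icc ε (1 - ε) := h2.2
    rw [h1]
    split_ifs
    · exact h3.1
    · linarith [h3.2]

theorem integrable_seqReg [IsProbabilityMeasure P] (hD : D.Admissible) (hNP : D.Nonparametric)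
    {ε : ℝ} (hε : 0 < ε) (hpos : (D.trueQ P).Positive P ε) {v : V} (hv : D.A < v) :
    Integrable (D.seqReg P v) P := by
  refine integrable_of_integrable_cond (sig_le _) (measurableSet_trtEq (D.lvl v)) hε
    (le_trueG hD hNP hpos hv) (stronglyMeasurable_seqReg v) ?_
  rw [seqReg, backward_eq]
  exact integrable_condExp

/-! ### The iterated integrals are the sequential regressions -/

section Target

variable [∀ v, StandardBorelSpace (S v)] [∀ v, Nonempty (S v)]

/-- Integrating out the variable of `v` against its regular conditional distribution within a stratum
of the treatment is a version of the regression within this stratum. -/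
theorem integral_condDistrib_update [IsProbabilityMeasure P] (hNP : D.Nonparametric) {ε : ℝ}
    (hε : 0 < ε) {v : V} (hv : D.A < v) (hg : ∀ᵐ o ∂P, ε ≤ D.trueG P v o)
    {J T : (∀ v, S v) → ℝ} (hJ : Measurable[D.sig (insert v (D.mpA v))] J) (hJT : J =ᵐ[P] T)
    (hT : Integrable T P) {K : (∀ v, S v) → ℝ}
    (hK : ∀ o, K o = ∫ z, J (Function.update o v z)
      ∂(condDistrib (fun o' : ∀ v, S v => o' v) (D.mpA v).domRestrict (P[|D.trtEq (D.lvl v)])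
        ((D.mpA v).domRestrict o))) :
    Measurable[D.sig (D.mpA v)] K ∧
      K =ᵐ[P] (P[|D.trtEq (D.lvl v)])[T | D.sig (D.mpA v)] := by
  classical
  have hvs : v ∉ D.mpA v := by
    rw [mpA_eq hNP hv]
    exact fun h => lt_irrefl v h.1
  obtain ⟨o₀⟩ : Nonempty (∀ v, S v) := inferInstance
  -- Coordinates outside the pillow and v are frozen at o₀; J does not see them.
  let glue : (∀ u : D.mpA v, S u) × S v → ∀ u, S u := fun p =>
    Function.update (fun u => if hu : u ∈ D.mpA v then p.1 ⟨u, hu⟩ else o₀ u) v p.2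
  have hglue : Measurable glue := by
    refine measurable_pi_lambda _ fun u => ?_
    by_cases huv : u = v
    · subst huv
      simpa only [glue, Function.update_self] using measurable_snd
    · simp only [glue, Function.update_of_ne huv]
      by_cases hu : u ∈ D.mpA v
      · simp only [hu, dif_pos]
        exact (measurable_pi_apply _).comp measurable_fst
      · simp only [hu, dif_neg, not_false_iff]
        exact measurable_const
  have hJm : StronglyMeasurable (fun p => J (glue p)) :=
    ((hJ.mono (sig_le _) le_rfl).comp hglue).stronglyMeasurable
  have hJg : ∀ o z, J (glue ((D.mpA v).domRestrict o, z)) = J (Function.update o v z) := by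
    intro o z
    refine hJ.factorsThrough ?_
    ext ⟨u, hu⟩
    change glue ((D.mpA v).domRestrict o, z) u = Function.update o v z u
    by_cases huv : u = v
    · subst huv
      simp [glue]
    · have hu' : u ∈ D.mpA v := hu.resolve_left huv
      simp [glue, huv, hu', Set.domRestrict]
  have hKeq : K = fun o => ∫ z, J (glue ((D.mpA v).domRestrict o, z))
      ∂(condDistrib (fun o' : ∀ v, S v => o' v) (D.mpA v).domRestrict (P[|D.trtEq (D.lvl v)])
        ((D.mpA v).domRestrict o)) := by
    ext o
    simp only [hK, hJg]
  have hKm : Measurable[D.sig (D.mpA v)] K := by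
    rw [hKeq]
    exact (StronglyMeasurable.integral_condDistrib hJm).measurable.comp (comap_measurable _)
  refine ⟨hKm, ?_⟩
  -- Disintegration gives equality only almost surely within the stratum; since both sides are
  -- functions of the pillow without A, positivity extends it to `P`.
  refine ae_eq_of_ae_eq_cond (sig_le _) (measurableSet_trtEq (D.lvl v)) hε hg
    hKm.stronglyMeasurable stronglyMeasurable_condExp ?_
  have hJT' : J =ᵐ[P[|D.trtEq (D.lvl v)]] T := cond_absolutelyContinuous.ae_le hJT
  have hJo : (fun o => J (glue ((D.mpA v).domRestrict o, o v))) = J := by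
    ext o
    rw [hJg, Function.update_eq_self]
  have h := condExp_prod_ae_eq_integral_condDistrib (μ := P[|D.trtEq (D.lvl v)])
    (X := (D.mpA v).domRestrict (π := S)) (Y := fun o => o v) (f := fun p => J (glue p))
    (Set.measurable_restrict _) (measurable_pi_apply v).aemeasurable hJm
    (by rw [hJo]; exact (integrable_cond hT).congr hJT'.symm)
  rw [hJo] at h
  rw [hKeq]
  exact h.symm.trans (condExp_congr_ae hJT')

theorem measurable_eval_sig {s : Set V} {u : V} (hu : u ∈ s) :
    Measurable[D.sig s] fun o : ∀ v, S v => o u :=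
  (measurable_pi_apply (⟨u, hu⟩ : s)).comp
    (comap_measurable (m := MeasurableSpace.pi) (s.domRestrict (π := S)))

/-- Backward induction from Y. Measurability is carried along because the next integration updates
coordinates inside the previous integral, so that integral must itself be a function of its own
arguments. -/
theorem iterInt_ae_eq_seqReg [IsProbabilityMeasure P] (hD : D.Admissible) (hNP : D.Nonparametric)
    (hY : Integrable D.y P) {ε : ℝ} (hε : 0 < ε) (hpos : (D.trueQ P).Positive P ε) {v : V}
    (hv : D.A < v) :
    Measurable[D.sig (D.mpA v)] (D.iterInt P v) ∧ D.iterInt P v =ᵐ[P] D.seqReg P v := by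
  induction v using WellFoundedGT.induction with
  | ind v ih =>
    by_cases h : v = D.Y
    · subst h
      rw [seqReg_Y hD]
      refine integral_condDistrib_update hNP hε hv (le_trueG hD hNP hpos hv) (J := D.y) ?_
        EventuallyEq.rfl hY fun o => ?_
      · exact D.out.measurable.comp (measurable_eval_sig (Set.mem_insert _ _))
      · rw [iterInt, backward_eq, if_pos ((isMax_iff_of_last hD.last).2 rfl)]
    · have hZ := mem_Z.2 ⟨hv, h⟩
      have ih' := ih (Order.succ v) (Order.lt_succ_of_not_isMax (not_isMax_of_mem_Z hD hZ))
        (A_lt_succ hD hZ)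
      rw [seqReg_of_mem_Z hD hZ]
      rw [mpA_succ hD hNP hZ] at ih'
      refine integral_condDistrib_update hNP hε hv (le_trueG hD hNP hpos hv) ih'.1 ih'.2
        (integrable_seqReg hD hNP hε hpos (A_lt_succ hD hZ)) fun o => ?_
      rw [iterInt, backward_eq, if_neg (not_isMax_of_mem_Z hD hZ)]

theorem target_eq [IsProbabilityMeasure P] (hD : D.Admissible) (hNP : D.Nonparametric)
    (hY : Integrable D.y P) {ε : ℝ} (hε : 0 < ε) (hpos : (D.trueQ P).Positive P ε) :
    D.target P = (∫ o, D.seqReg P D.Z₁ o * D.ind D.a₁ o ∂P) + ∫ o, D.ind D.a₀ o * D.y o ∂P := by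
  rw [target, propensity, ← mpA_Z₁ hD hNP]
  congr 1
  have hB := integrable_seqReg hD hNP hε hpos hD.A_lt_Z₁
  rw [← integral_mul_condExp (sig_le (D.mpA D.Z₁)) (stronglyMeasurable_seqReg D.Z₁)
    (integrable_ind P D.a₁) (hB.mul_bdd (measurable_ind _).aestronglyMeasurable
      (ae_of_all _ (abs_ind_le _)))]
  refine integral_congr_ae ?_
  filter_upwards [(iterInt_ae_eq_seqReg hD hNP hY hε hpos hD.A_lt_Z₁).2] with o ho
  rw [ho, mul_comm]

end Target

end Design

namespace Design

variable {V : Type*} [Fintype V] [LinearOrder V] [SuccOrder V]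
  {S : V → Type*} [∀ v, MeasurableSpace (S v)] {D : Design V S}
  {P : Measure (∀ v, S v)}

/-! ### The mean of the influence function at a nuisance estimate -/

namespace Nuisance

variable {Q : D.Nuisance}

/-- The uncentred influence function at `Q`, expanded around arbitrary regressions `B`. -/
theorem RegularAt.eif_eq (hD : D.Admissible) {ε : ℝ} (hε : 0 < ε) {o : ∀ v, S v}
    (ho : Q.RegularAt ε o) (B : V → (∀ v, S v) → ℝ) :
    Q.eif 0 o = B D.Z₁ o * D.ind D.a₁ o + D.ind D.a₀ o * D.y o
      + D.ind (D.lvl D.Y) o * Q.R D.Y o * (D.y o - B D.Y o)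
      + ∑ v ∈ D.Z, D.ind (D.lvl v) o * Q.R v o * (B (Order.succ v) o - B v o)
      + ∑ v ∈ D.Z, (if D.lvl (Order.succ v) = D.lvl v then 0 else
          (Q.B (Order.succ v) - B (Order.succ v)) o * (Q.R v o + Q.R (Order.succ v) o)
            * (D.ind (D.lvl v) o - Q.h v o))
      + (Q.B D.Z₁ - B D.Z₁) o * (-(1 + Q.ratioA o)) * (D.ind D.a₀ o - Q.g D.Z₁ o) := by
  -- Telescoping attaches the error at each vertex v + 1 to the weights of both v and v + 1; the
  -- boundary terms are absorbed by the Y term and the Z₁ term.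
  have htel := sum_succ_sub hD fun v => D.ind (D.lvl v) o * Q.R v o * (Q.B v o - B v o)
  have hsum : ∑ v ∈ D.Z, D.ind (D.lvl v) o * Q.R v o * (Q.B (Order.succ v) o - Q.B v o)
      = ∑ v ∈ D.Z, D.ind (D.lvl v) o * Q.R v o * (B (Order.succ v) o - B v o)
        + ∑ v ∈ D.Z, (if D.lvl (Order.succ v) = D.lvl v then 0 else
          (Q.B (Order.succ v) - B (Order.succ v)) o * (Q.R v o + Q.R (Order.succ v) o)
            * (D.ind (D.lvl v) o - Q.h v o))
        + ∑ v ∈ D.Z, (D.ind (D.lvl (Order.succ v)) o * Q.R (Order.succ v) o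
            * (Q.B (Order.succ v) o - B (Order.succ v) o)
          - D.ind (D.lvl v) o * Q.R v o * (Q.B v o - B v o)) := by
    rw [← Finset.sum_add_distrib, ← Finset.sum_add_distrib]
    refine Finset.sum_congr rfl fun v hv => ?_
    split_ifs with h
    · rw [RegularAt.R_succ_of_lvl_eq hD hv h, h]
      ring
    · have hR := ho.R_succ_of_lvl_ne hD hε hv h
      rw [ind_eq_one_sub h, Pi.sub_apply]
      -- Since the two indicators sum to 1, I_v 𝓡_v − I_{v+1} 𝓡_{v+1} = (𝓡_v + 𝓡_{v+1})I_v −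
      -- 𝓡_{v+1}, and `hR` factors this.
      linear_combination -(Q.B (Order.succ v) o - B (Order.succ v) o) * hR
  have ha : D.ind D.a₁ o = 1 - D.ind D.a₀ o := ind_eq_one_sub (by simp [a₁]) o
  have hg : Q.g D.Z₁ o * (1 + Q.ratioA o) = 1 := by
    have h0 : Q.g D.Z₁ o ≠ 0 := (hε.trans_le ho.first.1).ne'
    rw [ratioA]
    field_simp
    ring
  rw [eif, hsum, htel, lvl_Z₁ hD, R_Z₁ hD, ha, Pi.sub_apply]
  linear_combination -(Q.B D.Z₁ o - B D.Z₁ o) * hg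

theorem eif_eq_sub (c : ℝ) (o : ∀ v, S v) : Q.eif c o = Q.eif 0 o - c := by
  simp [eif]

theorem measurable_eif (hD : D.Admissible) (hNP : D.Nonparametric) (c : ℝ) :
    Measurable (Q.eif c) := by
  have hB : ∀ v, Measurable (Q.B v) := fun v => (Q.measurable_B v).mono (sig_le _) le_rfl
  have hR : ∀ v, D.A < v → Measurable (Q.R v) :=
    fun v hv => (measurable_R hD hNP hv).mono (sig_le _) le_rfl
  have hpi : Measurable Q.pi₁ := ((Q.measurable_g D.Z₁).mono (sig_le _) le_rfl).const_sub 1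
  have hind := measurable_ind (D := D)
  refine ((((((((hind _).mul (hR _ hD.A_lt_Y)).mul (measurable_y.sub (hB _))).add
    (Finset.measurable_fun_sum _ fun v hv => ?_)).add (((hind _).sub hpi).mul (hB _))).add
    (hpi.mul (hB _))).add ((hind _).mul measurable_y)).sub_const c)
  exact ((hind _).mul (hR _ (mem_Z.1 hv).1)).mul ((hB _).sub (hB _))

theorem RegularAt.abs_add_R_le {ε : ℝ} (hε : 0 < ε) {o : ∀ v, S v} (ho : Q.RegularAt ε o)
    (u v : V) : |Q.R u o + Q.R v o| ≤ 2 * weightBound V ε := by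
  have h := (abs_add_le (Q.R u o) (Q.R v o)).trans
    (add_le_add (ho.abs_R_le hε u) (ho.abs_R_le hε v))
  linarith

theorem RegularAt.abs_neg_one_add_ratioA_le {ε : ℝ} (hε : 0 < ε) {o : ∀ v, S v}
    (ho : Q.RegularAt ε o) : |-(1 + Q.ratioA o)| ≤ 2 * weightBound V ε := by
  have h1 := ho.one_le_inv hε
  have h2 := ho.ratioA_mem hε
  have h3 : ε⁻¹ ≤ weightBound V ε :=
    le_mul_of_one_le_right (zero_le_one.trans h1)
      (one_le_pow₀ (one_le_mul_of_one_le_of_one_le h1 h1))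
  rw [abs_neg, abs_of_nonneg (by linarith [h2.1])]
  linarith [h2.2]

theorem abs_le_one_of_mem_Icc {ε x : ℝ} (hε : 0 < ε) (hx : x ∈ Set.Icc ε (1 - ε)) : |x| ≤ 1 :=
  abs_le.2 ⟨by linarith [hx.1], by linarith [hx.2]⟩

variable (P Q) in
/-- The bound for the second order remainder: products of `L²(P)` errors of neighbours. -/
noncomputable def remainderBound (C : ℝ) : ℝ≥0∞ :=
  (∑ v ∈ D.Z, if D.lvl (Order.succ v) = D.lvl v then 0 else ENNReal.ofReal C *
      (eLpNorm (Q.B (Order.succ v) - D.seqReg P (Order.succ v)) 2 P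
        * eLpNorm (Q.h v - D.trueH P v) 2 P))
    + ENNReal.ofReal C * (eLpNorm (Q.B D.Z₁ - D.seqReg P D.Z₁) 2 P
        * eLpNorm (Q.g D.Z₁ - D.trueG P D.Z₁) 2 P)

section Mean

variable [∀ v, StandardBorelSpace (S v)] [∀ v, Nonempty (S v)] [IsProbabilityMeasure P]

/-- Integrates `RegularAt.eif_eq` at the true regressions: residual terms vanish, the leading terms
give ψ, and the error terms obey Cauchy–Schwarz. Finite L² errors supply integrability. -/
theorem integrable_eif_and_enorm_integral_sub_le (hD : D.Admissible) (hNP : D.Nonparametric)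
    (hY : Integrable D.y P) {δ : ℝ} (hδ : 0 < δ) (htrue : (D.trueQ P).Positive P δ)
    {ε : ℝ} (hε : 0 < ε) (hpos : Q.Positive P ε) (hcoh : Q.Coherent P)
    (hB : ∀ v, D.A < v → eLpNorm (Q.B v - D.seqReg P v) 2 P ≠ ∞) :
    Integrable (Q.eif 0) P ∧
      ‖∫ o, Q.eif 0 o ∂P - D.target P‖ₑ ≤ Q.remainderBound P (2 * weightBound V ε) := by
  have hreg := hpos.regularAt hcoh
  have hBt := fun {v : V} (hv : D.A < v) => integrable_seqReg (P := P) hD hNP hδ htrue hv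
  have hΔm : ∀ v, StronglyMeasurable[D.sig (D.mpA v)] (Q.B v - D.seqReg P v) :=
    fun v => (Q.measurable_B v).stronglyMeasurable.sub (stronglyMeasurable_seqReg v)
  have hΔ : ∀ v, D.A < v → Integrable (Q.B v - D.seqReg P v) P := fun v hv =>
    MemLp.integrable (q := 2) (by norm_num)
      ⟨((hΔm v).mono (sig_le _)).aestronglyMeasurable, (hB v hv).lt_top⟩
  have hRm : ∀ v, D.A < v → StronglyMeasurable[D.sig (D.mpA v)] (Q.R v) :=
    fun v hv => (measurable_R hD hNP hv).stronglyMeasurable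
  have hRC : ∀ v, ∀ᵐ o ∂P, |Q.R v o| ≤ weightBound V ε :=
    fun v => hreg.mono fun o ho => ho.abs_R_le hε v
  have hindm := fun a => (measurable_ind (D := D) a).aestronglyMeasurable (μ := P)
  have hind1 := fun a => ae_of_all P (abs_ind_le (D := D) a)
  have hwint : ∀ v, D.A < v → ∀ f : (∀ v, S v) → ℝ, Integrable f P →
      Integrable (fun o => D.ind (D.lvl v) o * Q.R v o * f o) P := by
    intro v hv f hf
    simp_rw [mul_assoc]
    exact (hf.bdd_mul ((hRm v hv).mono (sig_le _)).aestronglyMeasurable (hRC v)).bdd_mul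
      (hindm _) (hind1 _)
  -- the six parts of the expansion
  have i1 : Integrable (fun o => D.seqReg P D.Z₁ o * D.ind D.a₁ o) P :=
    (hBt hD.A_lt_Z₁).mul_bdd (hindm _) (hind1 _)
  have i2 : Integrable (fun o => D.ind D.a₀ o * D.y o) P := hY.bdd_mul (hindm _) (hind1 _)
  have i3 : Integrable (fun o => D.ind (D.lvl D.Y) o * Q.R D.Y o * (D.y o - D.seqReg P D.Y o)) P :=
    hwint D.Y hD.A_lt_Y _ (hY.sub (hBt hD.A_lt_Y))
  have e3 : ∫ o, D.ind (D.lvl D.Y) o * Q.R D.Y o * (D.y o - D.seqReg P D.Y o) ∂P = 0 := by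
    rw [seqReg_Y hD]
    exact integral_indicator_mul_sub_condExp_eq_zero (sig_le _) (measurableSet_trtEq _) hY
      (hRm _ hD.A_lt_Y) (hRC _)
  have i4 : ∀ v ∈ D.Z, Integrable (fun o => D.ind (D.lvl v) o * Q.R v o
      * (D.seqReg P (Order.succ v) o - D.seqReg P v o)) P := fun v hv =>
    hwint v (mem_Z.1 hv).1 _ ((hBt (A_lt_succ hD hv)).sub (hBt (mem_Z.1 hv).1))
  have e4 : ∀ v ∈ D.Z, ∫ o, D.ind (D.lvl v) o * Q.R v o
      * (D.seqReg P (Order.succ v) o - D.seqReg P v o) ∂P = 0 := by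
    intro v hv
    rw [seqReg_of_mem_Z hD hv]
    exact integral_indicator_mul_sub_condExp_eq_zero (sig_le _) (measurableSet_trtEq _)
      (hBt (A_lt_succ hD hv)) (hRm _ (mem_Z.1 hv).1) (hRC _)
  have hh1 : ∀ v ∈ D.Z, ∀ᵐ o ∂P, |Q.h v o| ≤ 1 :=
    fun v hv => hreg.mono fun o ho => abs_le_one_of_mem_Icc hε (ho.h_mem v hv)
  have hg1 : ∀ᵐ o ∂P, |Q.g D.Z₁ o| ≤ 1 :=
    hreg.mono fun o ho => abs_le_one_of_mem_Icc hε ho.first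
  have hRR : ∀ u v, ∀ᵐ o ∂P, |Q.R u o + Q.R v o| ≤ 2 * weightBound V ε :=
    fun u v => hreg.mono fun o ho => ho.abs_add_R_le hε u v
  have hA1 : ∀ᵐ o ∂P, |-(1 + Q.ratioA o)| ≤ 2 * weightBound V ε :=
    hreg.mono fun o ho => ho.abs_neg_one_add_ratioA_le hε
  have hRRm : ∀ v ∈ D.Z, StronglyMeasurable[D.sig (D.mpA (Order.succ v))]
      (fun o => Q.R v o + Q.R (Order.succ v) o) := fun v hv =>
    ((hRm v (mem_Z.1 hv).1).mono (sig_mono (mpA_subset hNP (mem_Z.1 hv).1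
      (Order.le_succ v)))).add (hRm _ (A_lt_succ hD hv))
  have hhm : ∀ v ∈ D.Z, StronglyMeasurable[D.sig (D.mpA (Order.succ v))] (Q.h v) := by
    intro v hv
    rw [mpA_succ hD hNP hv]
    exact (Q.measurable_h v).stronglyMeasurable
  have hAm : StronglyMeasurable[D.sig (D.mpA D.Z₁)] (fun o => -(1 + Q.ratioA o)) :=
    ((measurable_ratioA hD hNP hD.A_lt_Z₁).const_add 1).neg.stronglyMeasurable
  have hgm := (Q.measurable_g D.Z₁).stronglyMeasurable
  have i5 : ∀ v ∈ D.Z, Integrable (fun o => if D.lvl (Order.succ v) = D.lvl v then 0 else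
      (Q.B (Order.succ v) - D.seqReg P (Order.succ v)) o * (Q.R v o + Q.R (Order.succ v) o)
        * (D.ind (D.lvl v) o - Q.h v o)) P := by
    intro v hv
    split_ifs
    · exact integrable_zero _ _ _
    · have hD1 := (hΔ _ (A_lt_succ hD hv)).mul_bdd
        ((hRRm v hv).mono (sig_le _)).aestronglyMeasurable (hRR v _)
      simp_rw [mul_sub]
      exact (hD1.mul_bdd (hindm _) (hind1 _)).sub
        (hD1.mul_bdd ((hhm v hv).mono (sig_le _)).aestronglyMeasurable (hh1 v hv))
  have b5 : ∀ v ∈ D.Z, ‖∫ o, (if D.lvl (Order.succ v) = D.lvl v then 0 else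
      (Q.B (Order.succ v) - D.seqReg P (Order.succ v)) o * (Q.R v o + Q.R (Order.succ v) o)
        * (D.ind (D.lvl v) o - Q.h v o)) ∂P‖ₑ ≤
      if D.lvl (Order.succ v) = D.lvl v then 0 else ENNReal.ofReal (2 * weightBound V ε) *
      (eLpNorm (Q.B (Order.succ v) - D.seqReg P (Order.succ v)) 2 P
        * eLpNorm (Q.h v - D.trueH P v) 2 P) := by
    intro v hv
    split_ifs
    · simp
    · rw [trueH, ← mpA_succ hD hNP hv]
      exact enorm_integral_mul_sub_le (sig_le _) (hΔm _) (hRRm v hv) (hhm v hv)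
        (hΔ _ (A_lt_succ hD hv)) (hindm _) (hRR v _) (hind1 _) (hh1 v hv)
  have i6 : Integrable (fun o => (Q.B D.Z₁ - D.seqReg P D.Z₁) o * (-(1 + Q.ratioA o))
      * (D.ind D.a₀ o - Q.g D.Z₁ o)) P := by
    have hD1 := (hΔ _ hD.A_lt_Z₁).mul_bdd (hAm.mono (sig_le _)).aestronglyMeasurable hA1
    simp_rw [mul_sub]
    exact (hD1.mul_bdd (hindm _) (hind1 _)).sub
      (hD1.mul_bdd (hgm.mono (sig_le _)).aestronglyMeasurable hg1)
  have b6 : ‖∫ o, (Q.B D.Z₁ - D.seqReg P D.Z₁) o * (-(1 + Q.ratioA o))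
      * (D.ind D.a₀ o - Q.g D.Z₁ o) ∂P‖ₑ ≤ ENNReal.ofReal (2 * weightBound V ε) *
      (eLpNorm (Q.B D.Z₁ - D.seqReg P D.Z₁) 2 P
        * eLpNorm (Q.g D.Z₁ - D.trueG P D.Z₁) 2 P) := by
    rw [trueG, lvl_Z₁ hD]
    exact enorm_integral_mul_sub_le (sig_le _) (hΔm _) hAm hgm (hΔ _ hD.A_lt_Z₁) (hindm _) hA1
      (hind1 _) hg1
  have i4s := integrable_finsetSum _ i4
  have i5s := integrable_finsetSum _ i5
  have i12 := i1.add i2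
  have i123 := i12.add i3
  have i1234 := i123.add i4s
  have i12345 := i1234.add i5s
  have hae := hreg.mono fun o ho => ho.eif_eq hD hε (D.seqReg P)
  refine ⟨(i12345.add i6).congr (hae.mono fun o ho => ho.symm), ?_⟩
  have hint : ∫ o, Q.eif 0 o ∂P - D.target P
      = (∑ v ∈ D.Z, ∫ o, (if D.lvl (Order.succ v) = D.lvl v then 0 else
          (Q.B (Order.succ v) - D.seqReg P (Order.succ v)) o * (Q.R v o + Q.R (Order.succ v) o)
            * (D.ind (D.lvl v) o - Q.h v o)) ∂P)
        + ∫ o, (Q.B D.Z₁ - D.seqReg P D.Z₁) o * (-(1 + Q.ratioA o))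
            * (D.ind D.a₀ o - Q.g D.Z₁ o) ∂P := by
    have e6 := integral_add' i12345 i6
    rw [integral_add' i1234 i5s, integral_add' i123 i4s, integral_add' i12 i3,
      integral_add' i1 i2, e3, integral_finsetSum _ i4, integral_finsetSum _ i5,
      Finset.sum_eq_zero e4] at e6
    rw [(integral_congr_ae hae).trans e6, target_eq hD hNP hY hδ htrue]
    ring
  rw [hint, remainderBound]
  exact (enorm_add_le _ _).trans (add_le_add ((enorm_sum_le _ _).trans (Finset.sum_le_sum b5)) b6)

theorem integral_eif_trueQ (hD : D.Admissible) (hNP : D.Nonparametric)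
    (hY : Integrable D.y P) {δ : ℝ} (hδ : 0 < δ) (htrue : (D.trueQ P).Positive P δ) :
    Integrable ((D.trueQ P).eif 0) P ∧ ∫ o, (D.trueQ P).eif 0 o ∂P = D.target P := by
  have h0 : ∀ v, eLpNorm ((D.trueQ P).B v - D.seqReg P v) 2 P = 0 := by
    intro v
    have h : (D.trueQ P).B v - D.seqReg P v = 0 := sub_self _
    rw [h, eLpNorm_zero]
  have h := integrable_eif_and_enorm_integral_sub_le hD hNP hY hδ htrue hδ htrue
    (coherent_trueQ hD hNP) fun v _ => by rw [h0]; exact ENNReal.zero_ne_top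
  refine ⟨h.1, sub_eq_zero.1 (enorm_eq_zero.1 (le_antisymm (h.2.trans ?_) zero_le))⟩
  simp [remainderBound, h0]

end Mean

end Nuisance

end Design

namespace Design

variable {V : Type*} [Fintype V] [LinearOrder V] [SuccOrder V]
  {S : V → Type*} [∀ v, MeasurableSpace (S v)] {D : Design V S}
  {P : Measure (∀ v, S v)} {Ω : Type*} [MeasurableSpace Ω] {ρ : Measure Ω}

/-! ### The one-step estimator -/

theorem Nuisance.oneStep_eq (Q : D.Nuisance) {n : ℕ} (hn : 0 < n) (x : Fin n → ∀ v, S v) :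
    Q.oneStep n x = (∑ j, Q.eif 0 (x j)) / n := by
  have hn' : (n : ℝ) ≠ 0 := by exact_mod_cast hn.ne'
  simp only [oneStep, empEif]
  simp only [eif_eq_sub (Q.plugin n x)]
  rw [Finset.sum_sub_distrib, Finset.sum_const, Finset.card_univ, Fintype.card_fin, nsmul_eq_mul,
    sub_div, mul_div_cancel_left₀ _ hn']
  ring

/-- The centrings c and c₀ are arbitrary because constants cancel between P_n and P; this admits the
random plug-in centring used in the Donsker condition. -/
theorem Nuisance.oneStep_sub_eq [IsProbabilityMeasure P] (Q Q₀ : D.Nuisance)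
    (hQ : Integrable (Q.eif 0) P) (hQ₀ : Integrable (Q₀.eif 0) P) (c c₀ : ℝ) {n : ℕ} (hn : 0 < n)
    (x : Fin n → ∀ v, S v) (ψ : ℝ) (hψ : ∫ o, Q₀.eif 0 o ∂P = ψ) :
    Q.oneStep n x - ψ
      = ((∑ j, (Q.eif c - Q₀.eif c₀) (x j)) / n - ∫ o, (Q.eif c - Q₀.eif c₀) o ∂P)
        + ((∑ j, Q₀.eif 0 (x j)) / n - ∫ o, Q₀.eif 0 o ∂P) + (∫ o, Q.eif 0 o ∂P - ψ) := by
  have hn' : (n : ℝ) ≠ 0 := by exact_mod_cast hn.ne'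
  have hf : ∀ o, (Q.eif c - Q₀.eif c₀) o = Q.eif 0 o - Q₀.eif 0 o - (c - c₀) := by
    intro o
    rw [Pi.sub_apply, eif_eq_sub c, eif_eq_sub c₀]
    ring
  simp only [hf]
  have hint : ∫ o, (Q.eif 0 o - Q₀.eif 0 o - (c - c₀)) ∂P
      = ∫ o, Q.eif 0 o ∂P - ∫ o, Q₀.eif 0 o ∂P - (c - c₀) := by
    have hd : Integrable (fun o => Q.eif 0 o - Q₀.eif 0 o) P := hQ.sub hQ₀
    rw [integral_sub hd (integrable_const _), integral_sub hQ hQ₀, integral_const,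
      probReal_univ, one_smul]
  rw [hint, Q.oneStep_eq hn, Finset.sum_sub_distrib, Finset.sum_sub_distrib, Finset.sum_const,
    Finset.card_univ, Fintype.card_fin, nsmul_eq_mul, sub_div, sub_div,
    mul_div_cancel_left₀ _ hn', hψ]
  ring

theorem eLpNorm_sub_le_one [IsProbabilityMeasure P] {ε ε' : ℝ} (hε : 0 < ε) (hε' : 0 < ε')
    {f f' : (∀ v, S v) → ℝ} (hf : ∀ᵐ o ∂P, f o ∈ Set.Icc ε (1 - ε))
    (hf' : ∀ᵐ o ∂P, f' o ∈ Set.Icc ε' (1 - ε')) : eLpNorm (f - f') 2 P ≤ 1 := by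
  refine (eLpNorm_le_of_ae_bound (C := 1) ?_).trans (by simp)
  filter_upwards [hf, hf'] with o h h'
  rw [Pi.sub_apply, Real.norm_eq_abs, abs_le]
  exact ⟨by linarith [h.1, h'.2], by linarith [h.2, h'.1]⟩

/-! ### Consistency of both estimators. -/

section Consistency

variable [∀ v, StandardBorelSpace (S v)] [∀ v, Nonempty (S v)] [IsProbabilityMeasure P]
  {O : ℕ → Ω → ∀ v, S v} {Qhat : ℕ → Ω → D.Nuisance}

/-- Under the disjunctive conditions the second order remainder vanishes in probability. -/
theorem isLittleOP_remainderBound (hD : D.Admissible) {δ : ℝ} (hδ : 0 < δ)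
    (htrue : (D.trueQ P).Positive P δ) (hreg : D.RegularEstimates P ρ O Qhat)
    (hrob : D.RobustConditions P ρ Qhat) (C : ℝ) :
    IsLittleOP ρ fun n ω => (Qhat n ω).remainderBound P C := by
  obtain ⟨ε, hε, hpos⟩ := hreg.positive
  have hbh : ∀ v ∈ D.Z, IsBigOP ρ fun n ω => eLpNorm ((Qhat n ω).h v - D.trueH P v) 2 P :=
    fun v hv => IsBigOP.of_ae_bound (C := 1) fun n => (hpos n).mono fun ω hω =>
      eLpNorm_sub_le_one hε hδ ((hω.2 v hv).mono fun _ h => h.2) ((htrue.2 v hv).mono fun _ h => h.2)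
  have hbg : IsBigOP ρ fun n ω => eLpNorm ((Qhat n ω).g D.Z₁ - D.trueG P D.Z₁) 2 P :=
    IsBigOP.of_ae_bound (C := 1) fun n => (hpos n).mono fun ω hω =>
      eLpNorm_sub_le_one hε hδ hω.1 htrue.1
  refine IsLittleOP.add (IsLittleOP.sum _ fun v hv => ?_) ?_
  · by_cases h : D.lvl (Order.succ v) = D.lvl v
    · simp only [if_pos h]
      exact IsLittleOP.zero
    · simp only [if_neg h]
      refine IsLittleOP.const_mul ?_ ENNReal.ofReal_ne_top
      -- The neighbours v and v + 1 have different levels, so condition 2 applies if v + 1 is Y, and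
      -- condition 1 otherwise.
      have hor : D.ConsB P ρ Qhat (Order.succ v) ∨ (D.ConsH P ρ Qhat v ∧ D.ConsG P ρ Qhat v) := by
        by_cases hs : Order.succ v = D.Y
        · rw [hs] at h ⊢
          exact hrob.outcome v hv (Ne.symm h)
        · exact hrob.mediators _ (mem_Z.2 ⟨A_lt_succ hD hv, hs⟩) v hv
            (Order.lt_succ_of_not_isMax (not_isMax_of_mem_Z hD hv)) (Ne.symm h)
      rcases hor with hB | ⟨hH, -⟩
      · exact IsLittleOP.mul_isBigOP hB (hbh v hv)
      · exact (hreg.bounded _ (A_lt_succ hD hv)).mul_isLittleOP hH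
  · refine IsLittleOP.const_mul ?_ ENNReal.ofReal_ne_top
    rcases hrob.treatment D.Z₁ (Z₁_mem_M hD) with hB | hG
    · exact IsLittleOP.mul_isBigOP hB hbg
    · exact (hreg.bounded _ hD.A_lt_Z₁).mul_isLittleOP hG

theorem isLittleOP_oneStep_sub [IsProbabilityMeasure ρ] (hD : D.Admissible)
    (hNP : D.Nonparametric) (hY : Integrable D.y P) {δ : ℝ} (hδ : 0 < δ)
    (htrue : (D.trueQ P).Positive P δ) (hO : ∀ i, Measurable (O i)) (hindep : iIndepFun O ρ)
    (hlaw : ∀ i, Measure.map (O i) ρ = P) (hreg : D.RegularEstimates P ρ O Qhat)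
    (hrob : D.RobustConditions P ρ Qhat) :
    IsLittleOP ρ fun n ω => ‖(Qhat n ω).oneStep n (sample O n ω) - D.target P‖ₑ := by
  classical
  obtain ⟨ε, hε, hpos⟩ := hreg.positive
  obtain ⟨F, hF, hFmem⟩ := hreg.donsker
  have h0 := Nuisance.integral_eif_trueQ hD hNP hY hδ htrue
  have hemp := hF.isLittleOP_empiricalMean_sub hO hindep hlaw hFmem
  have hlln := isLittleOP_empiricalMean_sub hO hindep hlaw
    (Nuisance.measurable_eif (Q := D.trueQ P) hD hNP 0) h0.1
  have hrem := isLittleOP_remainderBound hD hδ htrue hreg hrob (2 * Nuisance.weightBound V ε)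
  -- Where some regression error has infinite norm the bias bound is unavailable; this summand makes
  -- the total bound ∞ there.
  have hfin : IsLittleOP ρ fun n ω => ∑ v with D.A < v, ({∞} : Set ℝ≥0∞).indicator (fun _ => ∞)
      (eLpNorm ((Qhat n ω).B v - D.seqReg P v) 2 P) :=
    IsLittleOP.sum _ fun v hv =>
      (hreg.bounded v (Finset.mem_filter.1 hv).2).isLittleOP_top_indicator
  refine (((hemp.add hlln).add hrem).add hfin).mono_ae ?_
  filter_upwards [eventually_gt_atTop 0] with n hn
  filter_upwards [hpos n, hreg.coherent n] with ω hω hcoh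
  by_cases hB : ∀ v, D.A < v → eLpNorm ((Qhat n ω).B v - D.seqReg P v) 2 P ≠ ∞
  · obtain ⟨hint, hle⟩ := Nuisance.integrable_eif_and_enorm_integral_sub_le hD hNP hY hδ htrue hε hω
      hcoh hB
    rw [Nuisance.oneStep_sub_eq (P := P) (Qhat n ω) (D.trueQ P) hint h0.1
      ((Qhat n ω).plugin n (sample O n ω)) (D.target P) hn _ _ h0.2]
    refine le_add_right ?_
    exact (enorm_add_le _ _).trans (add_le_add (enorm_add_le _ _) hle)
  · push Not at hB
    obtain ⟨v, hv, htop⟩ := hB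
    have hsum : ∑ v with D.A < v, ({∞} : Set ℝ≥0∞).indicator (fun _ => ∞)
        (eLpNorm ((Qhat n ω).B v - D.seqReg P v) 2 P) = ∞ := by
      refine ENNReal.sum_eq_top.2 ⟨v, by simpa using hv, ?_⟩
      rw [htop]
      simp
    rw [hsum, add_top]
    exact le_top

theorem tendstoInMeasure_of_isLittleOP {T : ℕ → Ω → ℝ} {c : ℝ}
    (h : IsLittleOP ρ fun n ω => ‖T n ω - c‖ₑ) :
    TendstoInMeasure ρ T atTop fun _ => c := by
  intro ε hε
  simpa only [edist_eq_enorm_sub] using h ε hε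

/-- The plug-in is the one-step estimator minus P_nΦ, and √n ≥ 1 for n ≥ 1, so targeting controls
the difference. -/
theorem isLittleOP_tmle_sub {ψ : ℝ} (htar : D.Targeted ρ O Qhat)
    (h : IsLittleOP ρ fun n ω => ‖(Qhat n ω).oneStep n (sample O n ω) - ψ‖ₑ) :
    IsLittleOP ρ fun n ω => ‖(Qhat n ω).tmle n (sample O n ω) - ψ‖ₑ := by
  refine (h.add htar).mono_ae ?_
  filter_upwards [eventually_ge_atTop 1] with n hn
  refine ae_of_all _ fun ω => ?_
  have heq : (Qhat n ω).tmle n (sample O n ω) - ψ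
      = ((Qhat n ω).oneStep n (sample O n ω) - ψ) - (Qhat n ω).empEif n (sample O n ω) := by
    rw [Nuisance.tmle, Nuisance.oneStep]
    ring
  rw [heq]
  refine enorm_sub_le.trans (add_le_add le_rfl ?_)
  rw [Real.enorm_eq_ofReal_abs]
  refine ENNReal.ofReal_le_ofReal (le_mul_of_one_le_left (abs_nonneg _) ?_)
  exact Real.one_le_sqrt.2 (by exact_mod_cast hn)

end Consistency

end Design

theorem mainTheorem8 {V : Type*} [Fintype V] [LinearOrder V] [SuccOrder V]
    {S : V → Type*} [∀ v, MeasurableSpace (S v)] [∀ v, StandardBorelSpace (S v)]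
    [∀ v, Nonempty (S v)]
    (D : Design V S) (hD : D.Admissible) (hNP : D.Nonparametric)
    (P : Measure (∀ v, S v)) [IsProbabilityMeasure P]
    (hY : Integrable D.y P) (hpos : ∃ ε : ℝ, 0 < ε ∧ (D.trueQ P).Positive P ε)
    {Ω : Type*} [MeasurableSpace Ω] (ρ : Measure Ω) [IsProbabilityMeasure ρ]
    (O : ℕ → Ω → ∀ v, S v) (hO : ∀ i, Measurable (O i)) (hindep : iIndepFun O ρ)
    (hlaw : ∀ i, Measure.map (O i) ρ = P) :
    (∀ Qhat : ℕ → Ω → D.Nuisance,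
      D.RegularEstimates P ρ O Qhat → D.RobustConditions P ρ Qhat →
      TendstoInMeasure ρ (fun n ω => (Qhat n ω).oneStep n (Design.sample O n ω)) atTop
        (fun _ => D.target P)) ∧
    (∀ Qstar : ℕ → Ω → D.Nuisance,
      D.RegularEstimates P ρ O Qstar → D.RobustConditions P ρ Qstar → D.Targeted ρ O Qstar →
      TendstoInMeasure ρ (fun n ω => (Qstar n ω).tmle n (Design.sample O n ω)) atTop
        (fun _ => D.target P)) := by
  obtain ⟨δ, hδ, htrue⟩ := hpos
  refine ⟨fun Qhat hreg hrob => ?_, fun Qstar hreg hrob htar => ?_⟩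
  · exact Design.tendstoInMeasure_of_isLittleOP
      (Design.isLittleOP_oneStep_sub hD hNP hY hδ htrue hO hindep hlaw hreg hrob)
  · exact Design.tendstoInMeasure_of_isLittleOP (Design.isLittleOP_tmle_sub htar
      (Design.isLittleOP_oneStep_sub hD hNP hY hδ htrue hO hindep hlaw hreg hrob))
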